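/- Theorem. There is a polynomial-time algorithm that decides Dominating Set Reconfiguration under Token Sliding ($\mathrm{DSR}_{\mathsf{TS}}$) on cographs. That is, there are a deterministic Turing machine $M$ and a polynomial $p$ such that for every cograph $G$ and all dominating multisets $D_{\mathsf s}, D_{\mathsf t}$ of $G$ of the same size (in particular, for all dominating sets of the same size), $M$, started on the encoding of $(G, D_{\mathsf s}, D_{\mathsf t})$, halts after at most $p(N)$ steps, where $N$ is the length of the encoding, with the answer "yes" if $D_{\mathsf s}$ is reconfigurable into $D_{\mathsf t}$ by token sliding, and with the answer "no" otherwise. Here the graphs are finite and simple, with vertex set $\{0,\dots,n-1\}$. The class of cographs is the smallest class of graphs that is closed under isomorphism, contains $K_1$, and contains with any two graphs $G_1, G_2$ their disjoint union $G_1\cup G_2$ and their join $G_1+G_2$ (the disjoint union together with all edges between $V(G_1)$ and $V(G_2)$). A multiset $D$ of vertices of $G$ is dominating if each vertex of $G$ belongs to $D$ or has a neighbor in $D$. $D_{\mathsf s}$ is reconfigurable into $D_{\mathsf t}$ by token sliding if there is a finite sequence $D_0 = D_{\mathsf s}, D_1, \dots, D_\ell = D_{\mathsf t}$ of dominating multisets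 of $G$ of size $|D_{\mathsf s}|$ such that for each $i<\ell$ there is an edge $uv$ of $G$ with $u \in D_i$ for which $D_{i+1}$ arises from $D_i$ by replacing one copy of $u$ by $v$. An instance is encoded by the adjacency matrix of $G$ followed by the multiplicities of all vertices in $D_{\mathsf s}$ and in $D_{\mathsf t}$, written in unary, so that $N = \Theta(n^2 + |D_{\mathsf s}|)$. -/

import Mathlib

/-- The join `G + H`: the disjoint union of `G` and `H` together with all edges between them. -/
def graphJoin {V W : Type} (G : SimpleGraph V) (H : SimpleGraph W) : SimpleGraph (V ⊕ W) :=
  SimpleGraph.sum G H ⊔ completeBipartiteGraph V W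

/-- Cographs, by the usual recursion: `K₁` is a cograph, and disjoint unions and joins of two
cographs are cographs.  The last clause says that the names of the vertices do not matter. -/
inductive IsCograph : {V : Type} → SimpleGraph V → Prop
  | single : IsCograph (⊥ : SimpleGraph Unit)
  | union {V W : Type} {G : SimpleGraph V} {H : SimpleGraph W} :
      IsCograph G → IsCograph H → IsCograph (SimpleGraph.sum G H)
  | join {V W : Type} {G : SimpleGraph V} {H : SimpleGraph W} :
      IsCograph G → IsCograph H → IsCograph (graphJoin G H)
  | iso {V W : Type} {G : SimpleGraph V} {H : SimpleGraph W} :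
      Nonempty (G ≃g H) → IsCograph G → IsCograph H

/-- A configuration of tokens (several tokens may share a vertex) is dominating if every vertex
carries a token or has a neighbor that carries one. -/
def IsDominating {V : Type} (G : SimpleGraph V) (D : Multiset V) : Prop :=
  ∀ v, v ∈ D ∨ ∃ u ∈ D, G.Adj u v

/-- `D'` arises from `D` by sliding one token along an edge `uv` of `G`, from `u` to `v`;
`R` is the multiset of the tokens that do not move. -/
def Slide {V : Type} (G : SimpleGraph V) (D D' : Multiset V) : Prop :=
  ∃ (u v : V) (R : Multiset V), G.Adj u v ∧ D = u ::ₘ R ∧ D' = v ::ₘ R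

/-- `Ds` is reconfigurable into `Dt` by token sliding: there is a finite sequence
`S 0 = Ds, S 1, …, S ℓ = Dt` of dominating multisets, each of the same size as `Ds`, in which
every term arises from the preceding one by sliding one token along an edge. -/
def Reconfigurable {V : Type} (G : SimpleGraph V) (Ds Dt : Multiset V) : Prop :=
  ∃ (l : ℕ) (S : ℕ → Multiset V), S 0 = Ds ∧ S l = Dt ∧
    (∀ i ≤ l, (S i).card = Ds.card ∧ IsDominating G (S i)) ∧
    ∀ i < l, Slide G (S i) (S (i + 1))

/-- The instances of dominating set reconfiguration under token sliding: a finite graph, with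
vertices numbered `0, …, n - 1`, and two dominating (multi)sets of the same size. -/
structure DSRInstance where
  /-- the number of vertices -/
  n : ℕ
  /-- the graph -/
  G : SimpleGraph (Fin n)
  /-- the initial configuration -/
  Ds : Multiset (Fin n)
  /-- the target configuration -/
  Dt : Multiset (Fin n)
  dominating_s : IsDominating G Ds
  dominating_t : IsDominating G Dt
  card_eq : Ds.card = Dt.card

open Computability (Γ')

/-- A list of binary words as one string: a comma after each word, and a `ket` at the end. -/
def encodeWords (L : List (List Bool)) : List Γ' :=
  L.flatMap (fun w => w.map Γ'.bit ++ [Γ'.comma]) ++ [Γ'.ket]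

open Classical in
/-- The adjacency matrix of a graph, as the list of its rows. -/
noncomputable def adjacencyRows {n : ℕ} (G : SimpleGraph (Fin n)) : List (List Bool) :=
  (List.finRange n).map fun i => (List.finRange n).map fun j => decide (G.Adj i j)

/-- A multiset of vertices as the list of the multiplicities of all vertices, in unary.  For a set,
this is its characteristic vector. -/
def tokenWords {n : ℕ} (D : Multiset (Fin n)) : List (List Bool) :=
  (List.finRange n).map fun i => List.replicate (D.count i) true

/-- The string that describes an instance, of length `n² + n + 2 * (n + k) + 3` for `n` vertices
and `k` tokens: the adjacency matrix, the initial and the target configuration. -/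
noncomputable def DSRInstance.encode (I : DSRInstance) : List Γ' :=
  encodeWords (adjacencyRows I.G) ++ encodeWords (tokenWords I.Ds) ++ encodeWords (tokenWords I.Dt)

/-- There is a (deterministic, multi-stack) Turing machine that, for each instance `a`, started on
the string `enc a`, halts with the correct answer to the question whether `P a` holds, after a
number of steps that is bounded by a polynomial in the length of `enc a`. -/
def PolyTimeDecidable {α Γ : Type} (enc : α → List Γ) (P : α → Prop) : Prop :=
  ∃ f : α → Bool, (∀ a, f a = true ↔ P a) ∧
    Nonempty (Turing.TM2ComputableInPolyTime enc Computability.encodeBool f)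

/-! A slide stays inside a connected component. So the number of tokens in each component is
invariant, and the components can be treated one after the other (`ReachOn.add`,
`reachable_of_compatible`). A component of a cograph is a single vertex, where nothing moves, or a
join of two nonempty sides `S` and `T`, where one token on each side already dominates.

In a join, three tokens suffice to occupy both sides and keep a spare token, and then all
configurations are mutually reachable (`reachOn_canonical`). One token alone reaches any other
dominating position in at most one step. The delicate case is that of two tokens. If two vertices of
one side, possibly equal, dominate the join, then every dominating pair can be moved there
(`reachOn_pair`). Otherwise each dominating pair has one token on each side, no token can change
sides, and each token is confined to a connected component of the graph induced on its side. Because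
there is no induced path on four vertices, such a component has diameter at most two
(`ClosePair.adj`), so two slides per token are enough.

All this can be said without naming `S` and `T`. A component is the set of vertices at distance at
most two. Some side contains a dominating pair if and only if there is a nonadjacent dominating pair
or a triangle of dominating edges (`Flexible`). A detour of a token through `c` is admissible if `c`
and the other token dominate (`Linked`). Hence `reconfigurable_iff_compatible` characterizes
reconfigurability by one fixed first-order condition with token counts, and no decomposition of the
cograph has to be computed.

A fixed formula is evaluated by nested loops over the vertices. The formula becomes a program with
counters (`FCmd.eval`), this becomes a structured program for stacks (`Cmd.toProg`), and this
becomes a Turing machine (`Prog.machine`). Multiplicities are written in unary, so all counters are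
bounded by the length of the input. Therefore every loop, even one that merely empties a counter,
can be a loop over the letters of the input, and a polynomial time bound can be read off the syntax
(`Cmd.time`). -/

/-! ### The structure of cographs -/

section Structure

variable {V : Type} (G : SimpleGraph V)

/-- `K` is a connected component of `G` that is the join of `S` and `T`. -/
structure IsJoinOn (K S T : Set V) : Prop where
  mem_iff : ∀ x, x ∈ K ↔ x ∈ S ∨ x ∈ T
  left : S.Nonempty
  right : T.Nonempty
  disjoint : ∀ x ∈ S, x ∉ T
  adj : ∀ x ∈ S, ∀ y ∈ T, G.Adj x y
  closed : ∀ x ∈ K, ∀ y, G.Adj x y → y ∈ K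

variable {G}

theorem IsJoinOn.symm {K S T : Set V} (h : IsJoinOn G K S T) : IsJoinOn G K T S where
  mem_iff x := (h.mem_iff x).trans or_comm
  left := h.right
  right := h.left
  disjoint x hx hx' := h.disjoint x hx' hx
  adj x hx y hy := (h.adj y hy x hx).symm
  closed := h.closed

theorem graphJoin_adj {V W : Type} {G : SimpleGraph V} {H : SimpleGraph W} {x y : V ⊕ W} :
    (graphJoin G H).Adj x y ↔ Sum.elim (fun a => Sum.elim (fun b => G.Adj a b) (fun _ => True) y)
      (fun a => Sum.elim (fun _ => True) (fun b => H.Adj a b) y) x := by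
  cases x <;> cases y <;> simp [graphJoin]

theorem IsCograph.nonempty (h : IsCograph G) : Nonempty V := by
  induction h with
  | single => infer_instance
  | union _ _ ih _ => exact ih.map Sum.inl
  | join _ _ ih _ => exact ih.map Sum.inl
  | iso e _ ih => exact ih.map e.some

/-- A cograph has no induced path with four vertices. -/
theorem IsCograph.adj_of_path (h : IsCograph G) : ∀ a b c d, G.Adj a b → G.Adj b c → G.Adj c d →
    G.Adj a c ∨ G.Adj b d ∨ G.Adj a d := by
  induction h with
  | single => simp
  | union _ _ ih ih' =>
    rintro (a | a) (b | b) (c | c) (d | d) <;> simp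
    · exact ih a b c d
    · exact ih' a b c d
  | join _ _ ih ih' =>
    rintro (a | a) (b | b) (c | c) (d | d) <;> simp [graphJoin_adj]
    · exact ih a b c d
    · exact ih' a b c d
  | iso e _ ih =>
    intro a b c d
    have := ih (e.some.symm a) (e.some.symm b) (e.some.symm c) (e.some.symm d)
    simpa only [SimpleGraph.Iso.map_adj_iff] using this

/-- Induction on the construction: a disjoint union keeps the decompositions of its parts, and in a
join the whole vertex set is one component, with the two parts as its sides. -/
theorem IsCograph.exists_isJoinOn (h : IsCograph G) :
    ∀ v, (∀ w, ¬ G.Adj v w) ∨ ∃ K S T, IsJoinOn G K S T ∧ v ∈ K := by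
  induction h with
  | single => simp
  | @union V W G H _ _ ih ih' =>
    rintro (v | v)
    · rcases ih v with h | ⟨K, S, T, h, hv⟩
      · left; rintro (w | w) <;> simp [h]
      · refine Or.inr ⟨Sum.inl '' K, Sum.inl '' S, Sum.inl '' T, ⟨?_, h.left.image _,
          h.right.image _, ?_, ?_, ?_⟩, Set.mem_image_of_mem _ hv⟩
        · rintro (x | x) <;> simp [h.mem_iff]
        · rintro _ ⟨x, hx, rfl⟩; simpa using h.disjoint x hx
        · rintro _ ⟨x, hx, rfl⟩ _ ⟨y, hy, rfl⟩; simpa using h.adj x hx y hy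
        · rintro _ ⟨x, hx, rfl⟩ (y | y) <;> simp
          exact h.closed x hx y
    · rcases ih' v with h | ⟨K, S, T, h, hv⟩
      · left; rintro (w | w) <;> simp [h]
      · refine Or.inr ⟨Sum.inr '' K, Sum.inr '' S, Sum.inr '' T, ⟨?_, h.left.image _,
          h.right.image _, ?_, ?_, ?_⟩, Set.mem_image_of_mem _ hv⟩
        · rintro (x | x) <;> simp [h.mem_iff]
        · rintro _ ⟨x, hx, rfl⟩; simpa using h.disjoint x hx
        · rintro _ ⟨x, hx, rfl⟩ _ ⟨y, hy, rfl⟩; simpa using h.adj x hx y hy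
        · rintro _ ⟨x, hx, rfl⟩ (y | y) <;> simp
          exact h.closed x hx y
  | @join V W G H hG hH _ _ =>
    have := hG.nonempty
    have := hH.nonempty
    intro v
    refine Or.inr ⟨Set.univ, Set.range Sum.inl, Set.range Sum.inr, ⟨?_, Set.range_nonempty _,
      Set.range_nonempty _, ?_, ?_, fun _ _ _ _ => Set.mem_univ _⟩, Set.mem_univ v⟩
    · rintro (x | x) <;> simp
    · rintro _ ⟨x, rfl⟩; simp
    · rintro _ ⟨x, rfl⟩ _ ⟨y, rfl⟩; simp [graphJoin_adj]
  | iso e _ ih =>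
    obtain ⟨e⟩ := e
    intro v
    rcases ih (e.symm v) with h | ⟨K, S, T, h, hv⟩
    · left
      intro w hw
      exact h (e.symm w) (e.symm.map_adj_iff.2 hw)
    · refine Or.inr ⟨e.symm ⁻¹' K, e.symm ⁻¹' S, e.symm ⁻¹' T, ⟨fun x => h.mem_iff _, ?_, ?_,
        fun x hx => h.disjoint _ hx, fun x hx y hy => e.symm.map_adj_iff.1 (h.adj _ hx _ hy),
        fun x hx y hy => h.closed _ hx _ (e.symm.map_adj_iff.2 hy)⟩, hv⟩
      · obtain ⟨x, hx⟩ := h.left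
        exact ⟨e x, by simpa using hx⟩
      · obtain ⟨x, hx⟩ := h.right
        exact ⟨e x, by simpa using hx⟩

/-- The vertices at distance at most two; in a cograph, they form a connected component. -/
def Near (G : SimpleGraph V) (v z : V) : Prop :=
  z = v ∨ G.Adj v z ∨ ∃ u, G.Adj v u ∧ G.Adj u z

/-- Vertices on different sides are adjacent, and vertices on the same side have every vertex of the
other side as a common neighbor. Thus the component is definable without reference to the join. -/
theorem IsJoinOn.near_iff {K S T : Set V} (h : IsJoinOn G K S T) {v : V} (hv : v ∈ K) (z : V) :
    Near G v z ↔ z ∈ K := by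
  constructor
  · rintro (rfl | hz | ⟨u, hu, hz⟩)
    · exact hv
    · exact h.closed v hv z hz
    · exact h.closed u (h.closed v hv u hu) z hz
  · intro hz
    obtain ⟨s, hs⟩ := h.left
    obtain ⟨t, ht⟩ := h.right
    rcases (h.mem_iff v).1 hv with hv | hv <;> rcases (h.mem_iff z).1 hz with hz | hz
    · exact Or.inr (Or.inr ⟨t, h.adj v hv t ht, (h.adj z hz t ht).symm⟩)
    · exact Or.inr (Or.inl (h.adj v hv z hz))
    · exact Or.inr (Or.inl (h.adj z hz v hv).symm)
    · exact Or.inr (Or.inr ⟨s, (h.adj s hs v hv).symm, h.adj s hs z hz⟩)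

/-- The connected component of a vertex of a cograph is a single vertex or a join. -/
theorem IsCograph.near_cases (h : IsCograph G) (v : V) :
    (∀ z, Near G v z ↔ z = v) ∨ ∃ S T, IsJoinOn G {z | Near G v z} S T := by
  rcases h.exists_isJoinOn v with h | ⟨K, S, T, h, hv⟩
  · left
    intro z
    simp [Near, h]
  · right
    have : {z | Near G v z} = K := Set.ext fun z => h.near_iff hv z
    exact ⟨S, T, this ▸ h⟩

theorem Near.refl (v : V) : Near G v v := Or.inl rfl

theorem Near.symm {v z : V} (h : Near G v z) : Near G z v := by
  rcases h with rfl | h | ⟨u, h, h'⟩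
  · exact Or.inl rfl
  · exact Or.inr (Or.inl h.symm)
  · exact Or.inr (Or.inr ⟨u, h'.symm, h.symm⟩)

theorem Near.adj (hG : IsCograph G) {v z w : V} (h : Near G v z) (hw : G.Adj z w) :
    Near G v w := by
  rcases hG.near_cases v with hv | ⟨S, T, hv⟩
  · rw [hv] at h
    subst h
    exact Or.inr (Or.inl hw)
  · exact hv.closed z h w hw

theorem Near.trans (hG : IsCograph G) {v u z : V} (h : Near G v u) (h' : Near G u z) :
    Near G v z := by
  rcases h' with rfl | h' | ⟨x, h', h''⟩
  · exact h
  · exact h.adj hG h'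
  · exact (h.adj hG h').adj hG h''

end Structure

/-! ### Sliding tokens within a connected component -/

section Component

variable {V : Type} {G : SimpleGraph V} {K S T : Set V}

/-- The tokens `P` dominate the vertices in `K`. -/
def DominatesOn (G : SimpleGraph V) (K : Set V) (P : Multiset V) : Prop :=
  ∀ z ∈ K, z ∈ P ∨ ∃ u ∈ P, G.Adj u z

/-- A token of a configuration that dominates `K` slides, and `K` remains dominated. -/
def StepOn (G : SimpleGraph V) (K : Set V) (P Q : Multiset V) : Prop :=
  DominatesOn G K P ∧ DominatesOn G K Q ∧ Slide G P Q

/-- Reachability by sliding tokens while `K` is dominated. -/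
def ReachOn (G : SimpleGraph V) (K : Set V) : Multiset V → Multiset V → Prop :=
  Relation.ReflTransGen (StepOn G K)

theorem ReachOn.symm {P Q : Multiset V} (h : ReachOn G K P Q) : ReachOn G K Q P := by
  have : Std.Symm (StepOn G K) := ⟨by
    rintro P Q ⟨hP, hQ, u, v, R, huv, h, h'⟩
    exact ⟨hQ, hP, v, u, R, huv.symm, h', h⟩⟩
  exact Relation.ReflTransGen.stdSymm.symm _ _ h

theorem reachOn_of_adj {u v : V} {R : Multiset V} (h : DominatesOn G K (u ::ₘ R))
    (h' : DominatesOn G K (v ::ₘ R)) (huv : G.Adj u v) :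
    ReachOn G K (u ::ₘ R) (v ::ₘ R) :=
  .single ⟨h, h', u, v, R, huv, rfl, rfl⟩

theorem DominatesOn.mono {P Q : Multiset V} (h : DominatesOn G K P) (hPQ : P ⊆ Q) :
    DominatesOn G K Q := by
  intro z hz
  rcases h z hz with h | ⟨u, hu, h⟩
  · exact Or.inl (hPQ h)
  · exact Or.inr ⟨u, hPQ hu, h⟩

namespace IsJoinOn

variable (J : IsJoinOn G K S T)

include J

theorem dominatesOn {P : Multiset V} {a b : V} (ha : a ∈ S) (hb : b ∈ T) (haP : a ∈ P)
    (hbP : b ∈ P) : DominatesOn G K P := by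
  intro z hz
  rcases (J.mem_iff z).1 hz with hz | hz
  · exact Or.inr ⟨b, hbP, (J.adj z hz b hb).symm⟩
  · exact Or.inr ⟨a, haP, J.adj a ha z hz⟩

/-- The resting tokens on `a` and `b` occupy both sides and dominate `K`, so any further token is
free to move. -/
theorem reachOn_slide {R : Multiset V} {a b u v : V} (ha : a ∈ S) (hb : b ∈ T) (haR : a ∈ R)
    (hbR : b ∈ R) (huv : G.Adj u v) : ReachOn G K (u ::ₘ R) (v ::ₘ R) :=
  reachOn_of_adj (J.dominatesOn ha hb (by simp [haR]) (by simp [hbR]))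
    (J.dominatesOn ha hb (by simp [haR]) (by simp [hbR])) huv

/-- With `s` and `t` occupied, the other tokens go to `t` one by one: directly from `S`, and via `s`
from `T`. The multiset `E` accumulates the tokens that are already there. -/
theorem reachOn_gather {s t : V} (hs : s ∈ S) (ht : t ∈ T) (R : Multiset V) :
    ∀ E : Multiset V, (∀ x ∈ R, x ∈ K) →
    ReachOn G K (s ::ₘ t ::ₘ (E + R)) (s ::ₘ t ::ₘ (E + Multiset.replicate R.card t)) := by
  induction R using Multiset.induction_on with
  | empty => intro E _; simpa using! Relation.ReflTransGen.refl
  | cons r R ih =>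
    intro E hR
    have h₁ : ReachOn G K (r ::ₘ s ::ₘ t ::ₘ (E + R)) (t ::ₘ s ::ₘ t ::ₘ (E + R)) := by
      rcases (J.mem_iff r).1 (hR r (by simp)) with hr | hr
      · exact J.reachOn_slide hs ht (by simp) (by simp) (J.adj r hr t ht)
      · exact (J.reachOn_slide hs ht (by simp) (by simp) (J.adj s hs r hr).symm).trans
          (J.reachOn_slide hs ht (by simp) (by simp) (J.adj s hs t ht))
    have h₂ := ih (t ::ₘ E) (fun x hx => hR x (by simp [hx]))
    have e₁ : s ::ₘ t ::ₘ (E + r ::ₘ R) = r ::ₘ s ::ₘ t ::ₘ (E + R) := by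
      rw [Multiset.add_cons, Multiset.cons_swap t r, Multiset.cons_swap s r]
    have e₂ : s ::ₘ t ::ₘ ((t ::ₘ E) + R) = t ::ₘ s ::ₘ t ::ₘ (E + R) := by
      rw [Multiset.cons_add, Multiset.cons_swap s t, Multiset.cons_swap s t]
    have e₃ : s ::ₘ t ::ₘ (E + Multiset.replicate (r ::ₘ R).card t) =
        s ::ₘ t ::ₘ ((t ::ₘ E) + Multiset.replicate R.card t) := by
      rw [Multiset.card_cons, Multiset.replicate_succ, Multiset.add_cons, Multiset.cons_add]
    rw [e₁, e₃]
    rw [e₂] at h₂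
    exact h₁.trans h₂

/-- The spare token `c` crosses to the prescribed vertex of the other side. The old token on that
side has thereby become spare and crosses back to the other prescribed vertex. -/
theorem reachOn_of_mixed {s t a b c : V} {R : Multiset V} (hs : s ∈ S) (ht : t ∈ T) (ha : a ∈ S)
    (hb : b ∈ T) (hc : c ∈ K) :
    ∃ d ∈ K, ReachOn G K (a ::ₘ b ::ₘ c ::ₘ R) (s ::ₘ t ::ₘ d ::ₘ R) := by
  rcases (J.mem_iff c).1 hc with hc | hc
  · refine ⟨a, (J.mem_iff a).2 (Or.inl ha), ?_⟩
    have h₁ : ReachOn G K (c ::ₘ a ::ₘ b ::ₘ R) (t ::ₘ a ::ₘ b ::ₘ R) :=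
      J.reachOn_slide ha hb (by simp) (by simp) (J.adj c hc t ht)
    have h₂ : ReachOn G K (b ::ₘ t ::ₘ a ::ₘ R) (s ::ₘ t ::ₘ a ::ₘ R) :=
      J.reachOn_slide ha ht (by simp) (by simp) (J.adj s hs b hb).symm
    have e₁ : a ::ₘ b ::ₘ c ::ₘ R = c ::ₘ a ::ₘ b ::ₘ R := by
      rw [Multiset.cons_swap b c, Multiset.cons_swap a c]
    have e₂ : t ::ₘ a ::ₘ b ::ₘ R = b ::ₘ t ::ₘ a ::ₘ R := by
      rw [Multiset.cons_swap a b, Multiset.cons_swap t b]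
    rw [e₁]
    rw [e₂] at h₁
    exact h₁.trans h₂
  · refine ⟨b, (J.mem_iff b).2 (Or.inr hb), ?_⟩
    have h₁ : ReachOn G K (c ::ₘ a ::ₘ b ::ₘ R) (s ::ₘ a ::ₘ b ::ₘ R) :=
      J.reachOn_slide ha hb (by simp) (by simp) (J.adj s hs c hc).symm
    have h₂ : ReachOn G K (a ::ₘ s ::ₘ b ::ₘ R) (t ::ₘ s ::ₘ b ::ₘ R) :=
      J.reachOn_slide hs hb (by simp) (by simp) (J.adj a ha t ht)
    have e₁ : a ::ₘ b ::ₘ c ::ₘ R = c ::ₘ a ::ₘ b ::ₘ R := by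
      rw [Multiset.cons_swap b c, Multiset.cons_swap a c]
    rw [e₁, Multiset.cons_swap s t]
    rw [Multiset.cons_swap s a] at h₁
    exact h₁.trans h₂

/-- If `c` lies in `S` like `a`, it may cross to `t`, since `a` and `t` then dominate. This reduces
to the mixed case. -/
theorem reachOn_of_left {s t a b c : V} {R : Multiset V} (hs : s ∈ S) (ht : t ∈ T) (ha : a ∈ S)
    (hb : b ∈ K) (hc : c ∈ K) (h : DominatesOn G K (a ::ₘ b ::ₘ c ::ₘ R)) :
    ∃ d ∈ K, ReachOn G K (a ::ₘ b ::ₘ c ::ₘ R) (s ::ₘ t ::ₘ d ::ₘ R) := by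
  rcases (J.mem_iff c).1 hc with hc | hc
  · have e₁ : a ::ₘ b ::ₘ c ::ₘ R = c ::ₘ a ::ₘ b ::ₘ R := by
      rw [Multiset.cons_swap b c, Multiset.cons_swap a c]
    rw [e₁] at h ⊢
    have h₁ : ReachOn G K (c ::ₘ a ::ₘ b ::ₘ R) (t ::ₘ a ::ₘ b ::ₘ R) :=
      reachOn_of_adj h (J.dominatesOn ha ht (by simp) (by simp)) (J.adj c hc t ht)
    rw [Multiset.cons_swap t a] at h₁
    obtain ⟨d, hd, h₂⟩ := J.reachOn_of_mixed (R := R) hs ht ha ht hb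
    exact ⟨d, hd, h₁.trans h₂⟩
  · rw [Multiset.cons_swap b c]
    exact J.reachOn_of_mixed hs ht ha hc hb

/-- At least three tokens can be moved to a canonical position. -/
theorem reachOn_canonical {s t : V} (hs : s ∈ S) (ht : t ∈ T) {P : Multiset V}
    (hP : ∀ x ∈ P, x ∈ K) (h : DominatesOn G K P) (hc : 3 ≤ P.card) :
    ReachOn G K P (s ::ₘ t ::ₘ Multiset.replicate (P.card - 2) t) := by
  obtain ⟨a, ha⟩ := Multiset.card_pos_iff_exists_mem.1 (by omega : 0 < P.card)
  obtain ⟨P, rfl⟩ := Multiset.exists_cons_of_mem ha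
  rw [Multiset.card_cons] at hc
  obtain ⟨b, hb⟩ := Multiset.card_pos_iff_exists_mem.1 (by omega : 0 < P.card)
  obtain ⟨P, rfl⟩ := Multiset.exists_cons_of_mem hb
  rw [Multiset.card_cons] at hc
  obtain ⟨c, hc'⟩ := Multiset.card_pos_iff_exists_mem.1 (by omega : 0 < P.card)
  obtain ⟨R, rfl⟩ := Multiset.exists_cons_of_mem hc'
  obtain ⟨d, hd, h₁⟩ : ∃ d ∈ K, ReachOn G K (a ::ₘ b ::ₘ c ::ₘ R) (s ::ₘ t ::ₘ d ::ₘ R) := by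
    rcases (J.mem_iff a).1 (hP a (by simp)) with ha | ha
    · exact J.reachOn_of_left hs ht ha (hP b (by simp)) (hP c (by simp)) h
    · obtain ⟨d, hd, h₁⟩ :=
        J.symm.reachOn_of_left ht hs ha (hP b (by simp)) (hP c (by simp)) h
      rw [Multiset.cons_swap t s] at h₁
      exact ⟨d, hd, h₁⟩
  have h₂ := J.reachOn_gather hs ht (d ::ₘ R) 0 (by
    intro x hx
    rcases Multiset.mem_cons.1 hx with rfl | hx
    · exact hd
    · exact hP x (by simp [hx]))
  simp only [zero_add, Multiset.card_cons] at h₂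
  have e : (a ::ₘ b ::ₘ c ::ₘ R).card - 2 = R.card + 1 := by simp
  rw [e]
  exact h₁.trans h₂

/-- If two tokens on one side of a join dominate it, then they can be reached from all pairs. -/
theorem reachOn_pair {x y p q : V} (hx : x ∈ T) (hy : y ∈ T) (h : DominatesOn G K {x, y})
    (hp : p ∈ K) (hq : q ∈ K) (hpq : DominatesOn G K {p, q}) : ReachOn G K {p, q} {x, y} := by
  -- The token on `b` goes to `x` while `a` guards `T`; then the token on `a` crosses to `y`.
  have left : ∀ {a b x y : V}, x ∈ T → y ∈ T → DominatesOn G K {x, y} → a ∈ S → b ∈ T →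
      (b = x ∨ G.Adj x b) → ReachOn G K {a, b} {x, y} := by
    intro a b x y hx hy h ha hb hbx
    have h₁ : ReachOn G K {a, b} {a, x} := by
      rcases hbx with rfl | hbx
      · exact .refl
      · rw [Multiset.pair_comm a b, Multiset.pair_comm a x]
        exact reachOn_of_adj (J.dominatesOn ha hb (by simp) (by simp))
          (J.dominatesOn ha hx (by simp) (by simp)) hbx.symm
    have h₂ : ReachOn G K {a, x} {y, x} :=
      reachOn_of_adj (J.dominatesOn ha hx (by simp) (by simp)) (by
        rwa [Multiset.pair_comm] at h) (J.adj a ha y hy)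
    rw [Multiset.pair_comm y x] at h₂
    exact h₁.trans h₂
  have mixed : ∀ {a b : V}, a ∈ S → b ∈ T → ReachOn G K {a, b} {x, y} := by
    intro a b ha hb
    have := h b ((J.mem_iff b).2 (Or.inr hb))
    simp only [Multiset.insert_eq_cons, Multiset.mem_cons, Multiset.mem_singleton,
      exists_eq_or_imp, exists_eq_left] at this
    -- The pair dominates `b` itself, so one of its two vertices is within reach of `b`.
    have : (b = x ∨ G.Adj x b) ∨ (b = y ∨ G.Adj y b) := by tauto
    rcases this with hb' | hb'
    · exact left hx hy h ha hb hb'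
    · rw [Multiset.pair_comm x y] at h ⊢
      exact left hy hx h ha hb hb'
  obtain ⟨s, hs⟩ := J.left
  rcases (J.mem_iff p).1 hp with hp | hp <;> rcases (J.mem_iff q).1 hq with hq | hq
  · have : ReachOn G K {p, q} {x, q} := reachOn_of_adj hpq
      (J.dominatesOn hq hx (by simp) (by simp)) (J.adj p hp x hx)
    rw [Multiset.pair_comm x q] at this
    exact this.trans (mixed hq hx)
  · exact mixed hp hq
  · rw [Multiset.pair_comm]
    exact mixed hq hp
  · have : ReachOn G K {p, q} {s, q} := reachOn_of_adj hpq
      (J.dominatesOn hs hq (by simp) (by simp)) (J.adj s hs p hp).symm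
    exact this.trans (mixed hs hq)

end IsJoinOn

/-- An edge whose ends dominate `K`. -/
def IsDominatingEdge (G : SimpleGraph V) (K : Set V) (x y : V) : Prop :=
  G.Adj x y ∧ DominatesOn G K {x, y}

/-- All dominating pairs in `K` can be reached from each other; in a join of `S` and `T`, this means
that there is a dominating pair in `S` or in `T`. -/
def Flexible (G : SimpleGraph V) (K : Set V) : Prop :=
  (∃ x y, x ∈ K ∧ y ∈ K ∧ DominatesOn G K {x, y} ∧ ¬ G.Adj x y) ∨
  ∃ x y z, x ∈ K ∧ y ∈ K ∧ z ∈ K ∧ IsDominatingEdge G K x y ∧ IsDominatingEdge G K y z ∧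
    IsDominatingEdge G K x z

/-- A token can slide from `a` to `a'` in at most two steps, while a token on `b` stays where it
is. -/
def Linked (G : SimpleGraph V) (K : Set V) (a a' b : V) : Prop :=
  a = a' ∨ G.Adj a a' ∨ ∃ c, G.Adj a c ∧ G.Adj c a' ∧ DominatesOn G K {c, b}

/-- Tokens on a dominating edge can slide, first the one, then the other, to a dominating edge. -/
def Aligned (G : SimpleGraph V) (K : Set V) (P Q : Multiset V) : Prop :=
  ∃ a b a' b', a ∈ K ∧ a ∈ P ∧ b ∈ P ∧ a' ∈ Q ∧ b' ∈ Q ∧ IsDominatingEdge G K a b ∧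
    IsDominatingEdge G K a' b ∧ IsDominatingEdge G K a' b' ∧ Linked G K a a' b ∧
    Linked G K b b' a'

theorem Linked.reachOn {a a' b : V} (h : Linked G K a a' b) (hab : DominatesOn G K {a, b})
    (hab' : DominatesOn G K {a', b}) : ReachOn G K {a, b} {a', b} := by
  rcases h with rfl | h | ⟨c, h, h', hc⟩
  · exact .refl
  · exact reachOn_of_adj hab hab' h
  · exact (reachOn_of_adj hab hc h).trans (reachOn_of_adj hc hab' h')

/-- Nonadjacent vertices lie on the same side, and two of the three vertices of a triangle do. -/
theorem Flexible.exists_pair (J : IsJoinOn G K S T) (h : Flexible G K) :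
    (∃ x ∈ S, ∃ y ∈ S, DominatesOn G K {x, y}) ∨ ∃ x ∈ T, ∃ y ∈ T, DominatesOn G K {x, y} := by
  rcases h with ⟨x, y, hx, hy, h, hxy⟩ | ⟨x, y, z, hx, hy, hz, h, h', h''⟩
  · rcases (J.mem_iff x).1 hx with hx | hx <;> rcases (J.mem_iff y).1 hy with hy | hy
    · exact Or.inl ⟨x, hx, y, hy, h⟩
    · exact absurd (J.adj x hx y hy) hxy
    · exact absurd (J.adj y hy x hx).symm hxy
    · exact Or.inr ⟨x, hx, y, hy, h⟩
  · rcases (J.mem_iff x).1 hx with hx | hx <;> rcases (J.mem_iff y).1 hy with hy | hy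
    · exact Or.inl ⟨x, hx, y, hy, h.2⟩
    · rcases (J.mem_iff z).1 hz with hz | hz
      · exact Or.inl ⟨x, hx, z, hz, h''.2⟩
      · exact Or.inr ⟨y, hy, z, hz, h'.2⟩
    · rcases (J.mem_iff z).1 hz with hz | hz
      · exact Or.inl ⟨y, hy, z, hz, h'.2⟩
      · exact Or.inr ⟨x, hx, z, hz, h''.2⟩
    · exact Or.inr ⟨x, hx, y, hy, h.2⟩

/-- If `x` and `y` are adjacent, any vertex of `T` completes a triangle of dominating edges. The
case `x = y` counts as nonadjacent. -/
theorem IsJoinOn.flexible (J : IsJoinOn G K S T) {x y : V} (hx : x ∈ S) (hy : y ∈ S)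
    (h : DominatesOn G K {x, y}) : Flexible G K := by
  obtain ⟨t, ht⟩ := J.right
  have hxK := (J.mem_iff x).2 (Or.inl hx)
  have hyK := (J.mem_iff y).2 (Or.inl hy)
  by_cases hxy : G.Adj x y
  · exact Or.inr ⟨x, y, t, hxK, hyK, (J.mem_iff t).2 (Or.inr ht), ⟨hxy, h⟩,
      ⟨J.adj y hy t ht, J.dominatesOn hy ht (by simp) (by simp)⟩,
      ⟨J.adj x hx t ht, J.dominatesOn hx ht (by simp) (by simp)⟩⟩
  · exact Or.inl ⟨x, y, hxK, hyK, h, hxy⟩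

/-- A sufficient condition for reachability in a connected component. -/
theorem IsJoinOn.reachOn (J : IsJoinOn G K S T) {P Q : Multiset V} (hP : ∀ x ∈ P, x ∈ K)
    (hQ : ∀ x ∈ Q, x ∈ K) (hPd : DominatesOn G K P) (hQd : DominatesOn G K Q)
    (hc : P.card = Q.card) (h : Flexible G K ∨ Aligned G K P Q ∨ 3 ≤ P.card) :
    ReachOn G K P Q := by
  obtain ⟨s, hs⟩ := J.left
  obtain ⟨t, ht⟩ := J.right
  by_cases h₃ : 3 ≤ P.card
  · have h₁ := J.reachOn_canonical hs ht hP hPd h₃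
    have h₂ := J.reachOn_canonical hs ht hQ hQd (hc ▸ h₃)
    rw [hc] at h₁
    exact h₁.trans h₂.symm
  have h₂ : P.card = 0 ∨ P.card = 1 ∨ P.card = 2 := by omega
  rcases h₂ with h₂ | h₂ | h₂
  · rw [Multiset.card_eq_zero] at h₂
    subst h₂
    simpa using hPd s ((J.mem_iff s).2 (Or.inl hs))
  · obtain ⟨p, rfl⟩ := Multiset.card_eq_one.1 h₂
    obtain ⟨q, rfl⟩ := Multiset.card_eq_one.1 (hc ▸ h₂)
    -- A single dominating token sees the target vertex, so at most one slide is needed.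
    have := hPd q (hQ q (by simp))
    simp only [Multiset.mem_singleton, exists_eq_left] at this
    rcases this with rfl | h
    · exact .refl
    · exact reachOn_of_adj (R := 0) hPd hQd h
  · obtain ⟨p, q, rfl⟩ := Multiset.card_eq_two.1 h₂
    obtain ⟨p', q', rfl⟩ := Multiset.card_eq_two.1 (hc ▸ h₂)
    rcases h with h | ⟨a, b, a', b', ha, haP, hbP, haQ, hbQ, h₁, h₂, h₃, h₄, h₅⟩ | h
    · have hp := hP p (by simp)
      have hq := hP q (by simp)
      have hp' := hQ p' (by simp)
      have hq' := hQ q' (by simp)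
      rcases h.exists_pair J with ⟨x, hx, y, hy, h⟩ | ⟨x, hx, y, hy, h⟩
      · exact (J.symm.reachOn_pair hx hy h hp hq hPd).trans
          (J.symm.reachOn_pair hx hy h hp' hq' hQd).symm
      · exact (J.reachOn_pair hx hy h hp hq hPd).trans (J.reachOn_pair hx hy h hp' hq' hQd).symm
    -- Alignment speaks only of membership; as the ends of an edge are distinct, they are all of a
    -- configuration of two tokens.
    · have pair : ∀ {a b p q : V}, a ∈ ({p, q} : Multiset V) → b ∈ ({p, q} : Multiset V) →
          a ≠ b → ({p, q} : Multiset V) = {a, b} := by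
        intro a b p q ha hb hab
        simp only [Multiset.insert_eq_cons, Multiset.mem_cons, Multiset.mem_singleton] at ha hb
        rcases ha with rfl | rfl <;> rcases hb with rfl | rfl
        · exact absurd rfl hab
        · rfl
        · exact Multiset.pair_comm _ _
        · exact absurd rfl hab
      rw [pair haP hbP h₁.1.ne, pair haQ hbQ h₃.1.ne]
      have r₁ := h₄.reachOn h₁.2 h₂.2
      have h₂' := h₂.2
      have h₃' := h₃.2
      rw [Multiset.pair_comm] at h₂' h₃'
      have r₂ := h₅.reachOn h₂' h₃'
      rw [Multiset.pair_comm b, Multiset.pair_comm b'] at r₂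
      exact r₁.trans r₂
    · omega

end Component

/-! ### Reconfigurability in cographs -/

section Reconfiguration

variable {V : Type} {G : SimpleGraph V}

/-- A token slides, and the new configuration is dominating. -/
def DominatingSlide (G : SimpleGraph V) (D D' : Multiset V) : Prop :=
  IsDominating G D' ∧ Slide G D D'

theorem Slide.card_eq {D D' : Multiset V} (h : Slide G D D') : D'.card = D.card := by
  obtain ⟨u, v, R, -, rfl, rfl⟩ := h
  simp

theorem reconfigurable_iff {Ds Dt : Multiset V} (h : IsDominating G Ds) :
    Reconfigurable G Ds Dt ↔ Relation.ReflTransGen (DominatingSlide G) Ds Dt := by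
  constructor
  · rintro ⟨l, S, rfl, rfl, hS, hl⟩
    have : ∀ i ≤ l, Relation.ReflTransGen (DominatingSlide G) (S 0) (S i) := by
      intro i
      induction i with
      | zero => exact fun _ => .refl
      | succ i ih => exact fun hi => (ih (by omega)).tail ⟨(hS _ hi).2, hl i hi⟩
    exact this l le_rfl
  · intro h'
    induction h' with
    | refl => exact ⟨0, fun _ => Ds, rfl, rfl, fun _ _ => ⟨rfl, h⟩, fun i hi => by omega⟩
    | @tail D D' _ hD ih =>
      obtain ⟨l, S, h₀, h₁, hS, hl⟩ := ih
      refine ⟨l + 1, fun i => if i ≤ l then S i else D', by simpa using h₀, by simp, ?_, ?_⟩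
      · intro i hi
        by_cases hil : i ≤ l
        · simpa [hil] using hS i hil
        · simp only [hil, if_false]
          exact ⟨by rw [hD.2.card_eq, ← h₁]; exact (hS l le_rfl).1, hD.1⟩
      · intro i hi
        by_cases hil : i < l
        · simpa [hil, hil.le, Nat.succ_le_iff] using hl i hil
        · obtain rfl : i = l := by omega
          simpa [h₁] using hD.2

/-- The resting tokens `R` take care of everything outside `K`, so a motion that keeps `K` dominated
keeps the whole graph dominated. -/
theorem ReachOn.add {K : Set V} {P Q R : Multiset V} (h : ReachOn G K P Q)
    (hR : ∀ z ∉ K, z ∈ R ∨ ∃ u ∈ R, G.Adj u z) :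
    Relation.ReflTransGen (DominatingSlide G) (P + R) (Q + R) := by
  refine Relation.ReflTransGen.lift (· + R) ?_ _ _ h
  rintro P Q ⟨-, hQ, u, v, E, huv, rfl, rfl⟩
  refine ⟨fun z => ?_, u, v, E + R, huv, by simp, by simp⟩
  by_cases hz : z ∈ K
  · rcases hQ z hz with h | ⟨w, hw, h⟩
    · exact Or.inl (Multiset.mem_add.2 (Or.inl h))
    · exact Or.inr ⟨w, Multiset.mem_add.2 (Or.inl hw), h⟩
  · rcases hR z hz with h | ⟨w, hw, h⟩
    · exact Or.inl (Multiset.mem_add.2 (Or.inr h))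
    · exact Or.inr ⟨w, Multiset.mem_add.2 (Or.inr hw), h⟩

/-- The vertices in the connected component of a vertex `v` of a cograph. -/
def component (G : SimpleGraph V) (v : V) : Set V :=
  {z | Near G v z}

theorem component_closed (hG : IsCograph G) (v : V) :
    ∀ x ∈ component G v, ∀ y, G.Adj x y → y ∈ component G v :=
  fun _ hx _ hxy => Near.adj hG hx hxy

theorem component_eq (hG : IsCograph G) {u v : V} (h : Near G v u) :
    component G u = component G v :=
  Set.ext fun _ => ⟨fun hz => Near.trans hG h hz, fun hz => Near.trans hG h.symm hz⟩

open Classical in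
/-- A condition on the tokens in the connected component of `v`. -/
def Compatible (G : SimpleGraph V) (Ds Dt : Multiset V) (v : V) : Prop :=
  (Ds.countP (· ∈ component G v) = Dt.countP (· ∈ component G v)) ∧
    (Flexible G (component G v) ∨ Aligned G (component G v) Ds Dt ∨
      3 ≤ Ds.countP (· ∈ component G v))

open Classical in
theorem IsDominating.dominatesOn_filter {K : Set V} {D : Multiset V} (h : IsDominating G D)
    (hK : ∀ x ∈ K, ∀ y, G.Adj x y → y ∈ K) : DominatesOn G K (D.filter (· ∈ K)) := by
  intro z hz
  rcases h z with h | ⟨u, hu, h⟩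
  · exact Or.inl (Multiset.mem_filter.2 ⟨h, hz⟩)
  · exact Or.inr ⟨u, Multiset.mem_filter.2 ⟨hu, hK z hz u h.symm⟩, h⟩

open Classical in
theorem Aligned.filter {K : Set V} {P Q : Multiset V} (h : Aligned G K P Q)
    (hK : ∀ x ∈ K, ∀ y, G.Adj x y → y ∈ K) :
    Aligned G K (P.filter (· ∈ K)) (Q.filter (· ∈ K)) := by
  obtain ⟨a, b, a', b', ha, haP, hbP, haQ, hbQ, h₁, h₂, h₃, h₄, h₅⟩ := h
  have hb := hK a ha b h₁.1
  have ha' := hK b hb a' h₂.1.symm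
  have hb' := hK a' ha' b' h₃.1
  exact ⟨a, b, a', b', ha, Multiset.mem_filter.2 ⟨haP, ha⟩, Multiset.mem_filter.2 ⟨hbP, hb⟩,
    Multiset.mem_filter.2 ⟨haQ, ha'⟩, Multiset.mem_filter.2 ⟨hbQ, hb'⟩, h₁, h₂, h₃, h₄, h₅⟩

open Classical in
-- On a single vertex, equal token numbers mean equal configurations; otherwise `IsJoinOn.reachOn`
-- applies.
theorem Compatible.reachOn (hG : IsCograph G) {Ds Dt : Multiset V} (hs : IsDominating G Ds)
    (ht : IsDominating G Dt) {v : V} (h : Compatible G Ds Dt v) :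
    ReachOn G (component G v) (Ds.filter (· ∈ component G v))
      (Dt.filter (· ∈ component G v)) := by
  have hK := component_closed hG v
  obtain ⟨hc, h⟩ := h
  rw [Multiset.countP_eq_card_filter, Multiset.countP_eq_card_filter] at hc
  rw [Multiset.countP_eq_card_filter] at h
  rcases hG.near_cases v with hv | ⟨S, T, J⟩
  · have eq : ∀ D : Multiset V, D.filter (· ∈ component G v) =
        Multiset.replicate (D.filter (· ∈ component G v)).card v := fun D =>
      Multiset.eq_replicate_card.2 fun x hx => (hv x).1 (Multiset.mem_filter.1 hx).2
    rw [eq Ds, eq Dt, hc]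
    exact .refl
  · exact IsJoinOn.reachOn J (fun x hx => (Multiset.mem_filter.1 hx).2)
      (fun x hx => (Multiset.mem_filter.1 hx).2) (hs.dominatesOn_filter hK)
      (ht.dominatesOn_filter hK) hc (h.imp_right (Or.imp_left fun h => h.filter hK))

open Classical in
-- The components are settled one by one, by induction on a set `F` of vertices whose components are
-- finished. In every component the intermediate configuration is either still the initial one or
-- already the target, so a component met twice causes no trouble.
theorem reachable_of_compatible [Finite V] (hG : IsCograph G) {Ds Dt : Multiset V}
    (hs : IsDominating G Ds) (ht : IsDominating G Dt) (h : ∀ v, Compatible G Ds Dt v) :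
    Relation.ReflTransGen (DominatingSlide G) Ds Dt := by
  have := Fintype.ofFinite V
  have key : ∀ F : Finset V, ∃ D, Relation.ReflTransGen (DominatingSlide G) Ds D ∧
      IsDominating G D ∧
      (∀ u ∈ F, D.filter (· ∈ component G u) = Dt.filter (· ∈ component G u)) ∧
      ∀ u, D.filter (· ∈ component G u) = Ds.filter (· ∈ component G u) ∨
        D.filter (· ∈ component G u) = Dt.filter (· ∈ component G u) := by
    intro F
    induction F using Finset.induction_on with
    | empty => exact ⟨Ds, .refl, hs, by simp, fun _ => Or.inl rfl⟩
    | insert v F _ ih =>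
      obtain ⟨D, hD, hd, hF, ha⟩ := ih
      rcases ha v with hv | hv
      · set R := D.filter (¬ · ∈ component G v) with hR
        have hKc := component_closed hG v
        have hDR : D = Ds.filter (· ∈ component G v) + R := by
          rw [← hv, hR, Multiset.filter_add_not]
        have hreach := ((h v).reachOn hG hs ht).add (R := R) (fun z hz => by
          rcases hd z with h | ⟨u, hu, h⟩
          · exact Or.inl (Multiset.mem_filter.2 ⟨h, hz⟩)
          · exact Or.inr ⟨u, Multiset.mem_filter.2 ⟨hu, fun hu' => hz (hKc u hu' z h)⟩, h⟩)
        rw [← hDR] at hreach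
        have same : ∀ u, Near G v u →
            (Dt.filter (· ∈ component G v) + R).filter (· ∈ component G u) =
              Dt.filter (· ∈ component G u) := by
          intro u hu
          rw [component_eq hG hu, Multiset.filter_add, hR, Multiset.filter_filter,
            Multiset.filter_filter]
          simp
        have other : ∀ u, ¬ Near G v u →
            (Dt.filter (· ∈ component G v) + R).filter (· ∈ component G u) =
              D.filter (· ∈ component G u) := by
          intro u hu
          have hdisj : ∀ z ∈ component G u, z ∉ component G v := fun z hz hz' =>
            hu (Near.trans hG hz' (Near.symm hz))
          rw [Multiset.filter_add, hR, Multiset.filter_filter, Multiset.filter_filter,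
            Multiset.filter_eq_nil.2 (fun z _ hz => hdisj z hz.1 hz.2), zero_add]
          exact Multiset.filter_congr fun z _ => ⟨fun hz => hz.1, fun hz => ⟨hz, hdisj z hz⟩⟩
        refine ⟨Dt.filter (· ∈ component G v) + R, hD.trans hreach, ?_, ?_, ?_⟩
        · intro z
          by_cases hz : z ∈ component G v
          · rcases (ht.dominatesOn_filter hKc) z hz with h | ⟨u, hu, h⟩
            · exact Or.inl (Multiset.mem_add.2 (Or.inl h))
            · exact Or.inr ⟨u, Multiset.mem_add.2 (Or.inl hu), h⟩
          · rcases hd z with h | ⟨u, hu, h⟩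
            · exact Or.inl (Multiset.mem_add.2 (Or.inr (Multiset.mem_filter.2 ⟨h, hz⟩)))
            · exact Or.inr ⟨u, Multiset.mem_add.2 (Or.inr (Multiset.mem_filter.2
                ⟨hu, fun hu' => hz (hKc u hu' z h)⟩)), h⟩
        · intro u hu
          by_cases huv : Near G v u
          · exact same u huv
          · rcases Finset.mem_insert.1 hu with rfl | hu
            · exact absurd (Near.refl u) huv
            · rw [other u huv, hF u hu]
        · intro u
          by_cases huv : Near G v u
          · exact Or.inr (same u huv)
          · rw [other u huv]
            exact ha u
      · refine ⟨D, hD, hd, ?_, ha⟩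
        intro u hu
        rcases Finset.mem_insert.1 hu with rfl | hu
        · exact hv
        · exact hF u hu
  obtain ⟨D, hD, -, hF, -⟩ := key Finset.univ
  have : D = Dt := by
    ext u
    have := congrArg (Multiset.count u) (hF u (Finset.mem_univ u))
    have hu : u ∈ component G u := Near.refl u
    rwa [Multiset.count_filter_of_pos hu, Multiset.count_filter_of_pos hu] at this
  exact this ▸ hD

/-- There is a path with at most two edges from `a` to `a'` in `S`. -/
def ClosePair (G : SimpleGraph V) (S : Set V) (a a' : V) : Prop :=
  a = a' ∨ G.Adj a a' ∨ ∃ c ∈ S, G.Adj a c ∧ G.Adj c a'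

/-- A path with three edges has a chord, and each possible chord shortens it to at most two edges
with the inner vertex still in `S`. So a token that walks within `S` never gets farther than two
steps from its start. -/
theorem ClosePair.adj (hG : IsCograph G) {S : Set V} {a a' v : V} (h : ClosePair G S a a')
    (ha' : a' ∈ S) (hv : G.Adj a' v) : ClosePair G S a v := by
  rcases h with rfl | h | ⟨c, hc, h, h'⟩
  · exact Or.inr (Or.inl hv)
  · exact Or.inr (Or.inr ⟨a', ha', h, hv⟩)
  · rcases hG.adj_of_path a c a' v h h' hv with h'' | h'' | h''
    · exact Or.inr (Or.inr ⟨a', ha', h'', hv⟩)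
    · exact Or.inr (Or.inr ⟨c, hc, h, h''⟩)
    · exact Or.inr (Or.inl h'')

theorem ClosePair.linked {K S T : Set V} (J : IsJoinOn G K S T) {a a' b : V}
    (h : ClosePair G S a a') (hb : b ∈ T) : Linked G K a a' b :=
  h.imp_right (Or.imp_right fun ⟨c, hc, h, h'⟩ =>
    ⟨c, h, h', J.dominatesOn hc hb (by simp) (by simp)⟩)

open Classical in
theorem Slide.countP_eq {K : Set V} (hK : ∀ x ∈ K, ∀ y, G.Adj x y → y ∈ K) {D D' : Multiset V}
    (h : Slide G D D') : D.countP (· ∈ K) = D'.countP (· ∈ K) := by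
  obtain ⟨u, v, R, huv, rfl, rfl⟩ := h
  have : u ∈ K ↔ v ∈ K := ⟨fun h => hK u h v huv, fun h => hK v h u huv.symm⟩
  simp only [Multiset.countP_cons, this]

open Classical in
/-- Unless a join is flexible, each side keeps its only token. -/
theorem IsJoinOn.aligned_of_reachable (hG : IsCograph G) {K S T : Set V} (J : IsJoinOn G K S T)
    {Ds Dt : Multiset V} (hs : IsDominating G Ds)
    (h : Relation.ReflTransGen (DominatingSlide G) Ds Dt) (hf : ¬ Flexible G K)
    (hc : Ds.countP (· ∈ K) < 3) : Aligned G K Ds Dt := by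
  -- No dominating configuration has its two tokens of `K` on the same side, for this would make `K`
  -- flexible.
  have pair : ∀ {D : Multiset V} {x y : V}, IsDominating G D → D.filter (· ∈ K) = {x, y} →
      (x ∈ S ∧ y ∈ S ∨ x ∈ T ∧ y ∈ T) → False := by
    intro D x y hD hxy h
    have hd := hD.dominatesOn_filter J.closed
    rw [hxy] at hd
    rcases h with ⟨hx, hy⟩ | ⟨hx, hy⟩
    · exact hf (J.flexible hx hy hd)
    · exact hf (J.symm.flexible hx hy hd)
  have start : ∃ a ∈ S, ∃ b ∈ T, Ds.filter (· ∈ K) = {a, b} := by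
    have hd := hs.dominatesOn_filter J.closed
    have hmem : ∀ x ∈ Ds.filter (· ∈ K), x ∈ S ∨ x ∈ T := fun x hx =>
      (J.mem_iff x).1 (Multiset.mem_filter.1 hx).2
    rw [Multiset.countP_eq_card_filter] at hc
    generalize hP : Ds.filter (· ∈ K) = P at *
    obtain h | h | h : P.card = 0 ∨ P.card = 1 ∨ P.card = 2 := by omega
    · rw [Multiset.card_eq_zero] at h
      obtain ⟨s, hs⟩ := J.left
      simpa [h] using hd s ((J.mem_iff s).2 (Or.inl hs))
    · obtain ⟨p, rfl⟩ := Multiset.card_eq_one.1 h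
      -- A single dominating token, counted twice, is a dominating pair on one side.
      have hd' : DominatesOn G K {p, p} := hd.mono (by simp)
      rcases hmem p (by simp) with hp | hp
      · exact absurd (J.flexible hp hp hd') hf
      · exact absurd (J.symm.flexible hp hp hd') hf
    · obtain ⟨p, q, rfl⟩ := Multiset.card_eq_two.1 h
      rcases hmem p (by simp) with hp | hp <;> rcases hmem q (by simp) with hq | hq
      · exact (pair hs hP (Or.inl ⟨hp, hq⟩)).elim
      · exact ⟨p, hp, q, hq, rfl⟩
      · exact ⟨q, hq, p, hp, Multiset.pair_comm _ _⟩
      · exact (pair hs hP (Or.inr ⟨hp, hq⟩)).elim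
  obtain ⟨a, ha, b, hb, hab⟩ := start
  -- The invariant of the motion: one token on each side, each close to its starting point within
  -- its side.
  have key : ∃ a' ∈ S, ∃ b' ∈ T, Dt.filter (· ∈ K) = {a', b'} ∧ ClosePair G S a a' ∧
      ClosePair G T b b' := by
    induction h with
    | refl => exact ⟨a, ha, b, hb, hab, Or.inl rfl, Or.inl rfl⟩
    | @tail D D' _ hD ih =>
      obtain ⟨a', ha', b', hb', hab', hca, hcb⟩ := ih
      obtain ⟨hD', u, v, R, huv, rfl, rfl⟩ := hD
      by_cases hu : u ∈ K
      · have hv := J.closed u hu v huv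
        rw [Multiset.filter_cons_of_pos _ hu] at hab'
        rw [Multiset.filter_cons_of_pos _ hv]
        have hu' : u = a' ∨ u = b' := by
          have : u ∈ u ::ₘ R.filter (· ∈ K) := Multiset.mem_cons_self _ _
          rw [hab'] at this
          simpa using this
        rcases hu' with rfl | rfl
        · rw [Multiset.insert_eq_cons, Multiset.cons_inj_right] at hab'
          rw [hab']
          rcases (J.mem_iff v).1 hv with hv | hv
          · exact ⟨v, hv, b', hb', rfl, hca.adj hG ha' huv, hcb⟩
          · exact (pair hD' (by rw [Multiset.filter_cons_of_pos _
              ((J.mem_iff v).2 (Or.inr hv)), hab']; rfl) (Or.inr ⟨hv, hb'⟩)).elim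
        · rw [Multiset.pair_comm, Multiset.insert_eq_cons, Multiset.cons_inj_right] at hab'
          rw [hab']
          rcases (J.mem_iff v).1 hv with hv | hv
          · exact (pair hD' (by rw [Multiset.filter_cons_of_pos _
              ((J.mem_iff v).2 (Or.inl hv)), hab']; rfl) (Or.inl ⟨hv, ha'⟩)).elim
          · exact ⟨a', ha', v, hv, Multiset.pair_comm _ _, hca, hcb.adj hG hb' huv⟩
      · have hv : v ∉ K := fun hv => hu (J.closed v hv u huv.symm)
        rw [Multiset.filter_cons_of_neg _ hu] at hab'
        rw [Multiset.filter_cons_of_neg _ hv]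
        exact ⟨a', ha', b', hb', hab', hca, hcb⟩
  obtain ⟨a', ha', b', hb', hab', hca, hcb⟩ := key
  have mem : ∀ {D : Multiset V} {x y : V}, D.filter (· ∈ K) = {x, y} → x ∈ D ∧ y ∈ D := by
    intro D x y h
    have hle := Multiset.filter_le (· ∈ K) D
    rw [h] at hle
    exact ⟨Multiset.mem_of_le hle (by simp), Multiset.mem_of_le hle (by simp)⟩
  have edge : ∀ {x y : V}, x ∈ S → y ∈ T → IsDominatingEdge G K x y := fun hx hy =>
    ⟨J.adj _ hx _ hy, J.dominatesOn hx hy (by simp) (by simp)⟩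
  exact ⟨a, b, a', b', (J.mem_iff a).2 (Or.inl ha), (mem hab).1, (mem hab).2, (mem hab').1,
    (mem hab').2, edge ha hb, edge ha' hb, edge ha' hb', hca.linked J hb, hcb.linked J.symm ha'⟩

/-- Reconfigurability in a cograph can be decided in each connected component separately. -/
theorem reconfigurable_iff_compatible [Finite V] (hG : IsCograph G) {Ds Dt : Multiset V}
    (hs : IsDominating G Ds) (ht : IsDominating G Dt) :
    Reconfigurable G Ds Dt ↔ ∀ v, Compatible G Ds Dt v := by
  classical
  rw [reconfigurable_iff hs]
  refine ⟨fun h v => ⟨?_, ?_⟩, reachable_of_compatible hG hs ht⟩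
  · clear ht
    induction h with
    | refl => rfl
    | tail _ hD ih => exact ih.trans (hD.2.countP_eq (component_closed hG v))
  · rcases hG.near_cases v with hv | ⟨S, T, J⟩
    -- A single vertex is flexible: taken twice, it is a nonadjacent dominating pair.
    · refine Or.inl (Or.inl ⟨v, v, Near.refl v, Near.refl v, fun z hz => Or.inl ?_, G.irrefl⟩)
      simp [(hv z).1 hz]
    · by_cases hf : Flexible G (component G v)
      · exact Or.inl hf
      · by_cases hc : 3 ≤ Ds.countP (· ∈ component G v)
        · exact Or.inr (Or.inr hc)
        · exact Or.inr (Or.inl (IsJoinOn.aligned_of_reachable hG J hs h hf (not_le.1 hc)))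

end Reconfiguration

/-! ### Structured programs for multi-stack Turing machines -/

/-- Structured programs that work on a collection of stacks and on an internal state.
`drain k f p` pops the letters of stack `k` one by one, until the stack is empty; each of them is
absorbed into the internal state by `f`, and then `p` is executed. -/
inductive Prog {K : Type} (Γ : K → Type) (σ : Type) : Type
  | push (k : K) (f : σ → Γ k) : Prog Γ σ
  | pop (k : K) : Prog Γ σ
  | load (f : σ → σ) : Prog Γ σ
  | seq (p q : Prog Γ σ) : Prog Γ σ
  | ite (b : σ → Bool) (p q : Prog Γ σ) : Prog Γ σ
  | ifEmpty (k : K) (p q : Prog Γ σ) : Prog Γ σ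
  | drain (k : K) (f : Γ k → σ → σ) (p : Prog Γ σ) : Prog Γ σ

namespace Prog

variable {K : Type} {Γ : K → Type} {σ : Type}

/-- The control points of a program. -/
def Label : Prog Γ σ → Type
  | push _ _ => Unit
  | pop _ => Unit
  | load _ => Unit
  | seq p q => p.Label ⊕ q.Label
  | ite _ p q => Option (p.Label ⊕ q.Label)
  | ifEmpty _ p q => Option (p.Label ⊕ q.Label)
  | drain _ _ p => Option p.Label

instance finite_label : (p : Prog Γ σ) → Finite p.Label
  | push _ _ => inferInstanceAs (Finite Unit)
  | pop _ => inferInstanceAs (Finite Unit)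
  | load _ => inferInstanceAs (Finite Unit)
  | seq p q => by
    have := finite_label p
    have := finite_label q
    exact inferInstanceAs (Finite (p.Label ⊕ q.Label))
  | ite _ p q => by
    have := finite_label p
    have := finite_label q
    exact inferInstanceAs (Finite (Option (p.Label ⊕ q.Label)))
  | ifEmpty _ p q => by
    have := finite_label p
    have := finite_label q
    exact inferInstanceAs (Finite (Option (p.Label ⊕ q.Label)))
  | drain _ _ p => by
    have := finite_label p
    exact inferInstanceAs (Finite (Option p.Label))

/-- The control point at which a program starts. -/
def entry : (p : Prog Γ σ) → p.Label
  | push _ _ => ()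
  | pop _ => ()
  | load _ => ()
  | seq p _ => Sum.inl p.entry
  | ite _ _ _ => none
  | ifEmpty _ _ _ => none
  | drain _ _ _ => none

open Turing.TM2 in
/-- The statements of a Turing machine that executes a program, whose control points are named by
`e`, and that then jumps to `x`.  The machine has one more bit of memory, for the outcome of a test
of emptiness. -/
def code {Λ : Type} : (p : Prog Γ σ) → (p.Label → Λ) → Λ → p.Label → Stmt Γ Λ (σ × Bool)
  | push k f, _, x => fun _ => .push k (fun s => f s.1) (.goto fun _ => x)
  | pop k, _, x => fun _ => .pop k (fun s _ => s) (.goto fun _ => x)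
  | load f, _, x => fun _ => .load (fun s => (f s.1, s.2)) (.goto fun _ => x)
  | seq p q, e, x =>
    Sum.elim (p.code (fun l => e (Sum.inl l)) (e (Sum.inr q.entry)))
      (q.code (fun l => e (Sum.inr l)) x)
  | ite b p q, e, x => fun l =>
    match l with
    | none => .branch (fun s => b s.1) (.goto fun _ => e (some (Sum.inl p.entry)))
        (.goto fun _ => e (some (Sum.inr q.entry)))
    | some l => Sum.elim (p.code (fun l => e (some (Sum.inl l))) x)
        (q.code (fun l => e (some (Sum.inr l))) x) l
  | ifEmpty k p q, e, x => fun l =>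
    match l with
    | none => .peek k (fun s o => (s.1, o.isNone))
        (.branch (fun s => s.2) (.goto fun _ => e (some (Sum.inl p.entry)))
          (.goto fun _ => e (some (Sum.inr q.entry))))
    | some l => Sum.elim (p.code (fun l => e (some (Sum.inl l))) x)
        (q.code (fun l => e (some (Sum.inr l))) x) l
  | drain k f p, e, x => fun l =>
    match l with
    | none => .pop k (fun s o => o.elim (s.1, false) fun a => (f a s.1, true))
        (.branch (fun s => s.2) (.goto fun _ => e (some p.entry)) (.goto fun _ => x))
    | some l => p.code (fun l => e (some l)) (e none) l

variable [DecidableEq K]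

/-- `Exec p s S n s' S'`: the program `p`, started in the internal state `s` with the stacks `S`,
terminates after `n` steps in the internal state `s'` with the stacks `S'`. -/
inductive Exec :
    Prog Γ σ → σ → (∀ k, List (Γ k)) → ℕ → σ → (∀ k, List (Γ k)) → Prop
  | push {k f s S} : Exec (push k f) s S 1 s (Function.update S k (f s :: S k))
  | pop {k s S} : Exec (pop k) s S 1 s (Function.update S k (S k).tail)
  | load {f s S} : Exec (load f) s S 1 (f s) S
  | seq {p q s S n s' S' m s'' S''} : Exec p s S n s' S' → Exec q s' S' m s'' S'' →
      Exec (seq p q) s S (n + m) s'' S''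
  | ite_true {b p q s S n s' S'} : b s = true → Exec p s S n s' S' →
      Exec (ite b p q) s S (1 + n) s' S'
  | ite_false {b p q s S n s' S'} : b s = false → Exec q s S n s' S' →
      Exec (ite b p q) s S (1 + n) s' S'
  | empty {k p q s S n s' S'} : S k = [] → Exec p s S n s' S' →
      Exec (ifEmpty k p q) s S (1 + n) s' S'
  | nonempty {k p q s S n s' S'} : S k ≠ [] → Exec q s S n s' S' →
      Exec (ifEmpty k p q) s S (1 + n) s' S'
  | drain_nil {k f p s S} : S k = [] → Exec (drain k f p) s S 1 s S
  | drain_cons {k f p s S a l n s' S' m s'' S''} : S k = a :: l →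
      Exec p (f a s) (Function.update S k l) n s' S' →
      Exec (drain k f p) s' S' m s'' S'' →
      Exec (drain k f p) s S (1 + (n + m)) s'' S''

/-- `Steps M n c c'`: the machine `M` goes from `c` to `c'` in `n` steps. -/
def Steps {Λ τ : Type} (M : Λ → Turing.TM2.Stmt Γ Λ τ) (n : ℕ) (c c' : Turing.TM2.Cfg Γ Λ τ) :
    Prop :=
  (flip bind (Turing.TM2.step M))^[n] (some c) = some c'

theorem Steps.trans {Λ τ : Type} {M : Λ → Turing.TM2.Stmt Γ Λ τ} {n m : ℕ}
    {c c' c'' : Turing.TM2.Cfg Γ Λ τ} (h : Steps M n c c') (h' : Steps M m c' c'') :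
    Steps M (n + m) c c'' := by
  unfold Steps at *
  rw [Nat.add_comm, Function.iterate_add_apply, h, h']

theorem Steps.one {Λ τ : Type} {M : Λ → Turing.TM2.Stmt Γ Λ τ} {l : Λ} {v : τ}
    {S : ∀ k, List (Γ k)} {q : Turing.TM2.Stmt Γ Λ τ} {c : Turing.TM2.Cfg Γ Λ τ}
    (hM : M l = q) (h : Turing.TM2.stepAux q v S = c) : Steps M 1 ⟨some l, v, S⟩ c :=
  congrArg some ((congrArg (fun q => Turing.TM2.stepAux q v S) hM).trans h)

/-- Each unit of time of `Exec` is one step of the machine; a `seq` costs nothing, as the first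
program exits directly to the entry of the second. The naming `e` and the exit `x` are arbitrary so
that the induction reaches subprograms inside a larger machine. The test bit is overwritten before
each use, so its final value is irrelevant. -/
theorem Exec.steps {Λ : Type} {p : Prog Γ σ} {s S n s' S'} (h : Exec p s S n s' S')
    (M : Λ → Turing.TM2.Stmt Γ Λ (σ × Bool)) :
    ∀ (e : p.Label → Λ) (x : Λ), (∀ l, M (e l) = p.code e x l) → ∀ b, ∃ b',
      Steps M n ⟨some (e p.entry), (s, b), S⟩ ⟨some x, (s', b'), S'⟩ := by
  induction h with
  | push => intro e x hM b; exact ⟨b, Steps.one (hM ()) (by simp [code])⟩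
  | pop => intro e x hM b; exact ⟨b, Steps.one (hM ()) (by simp [code])⟩
  | load => intro e x hM b; exact ⟨b, Steps.one (hM ()) (by simp [code])⟩
  | seq _ _ ih ih' =>
    intro e x hM b
    obtain ⟨b', h'⟩ := ih _ _ (fun l => hM (Sum.inl l)) b
    obtain ⟨b'', h''⟩ := ih' _ _ (fun l => hM (Sum.inr l)) b'
    exact ⟨b'', h'.trans h''⟩
  | ite_true hb _ ih =>
    intro e x hM b
    obtain ⟨b', h'⟩ := ih _ _ (fun l => hM (some (Sum.inl l))) b
    exact ⟨b', (Steps.one (hM none) (by simp [code, hb])).trans h'⟩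
  | ite_false hb _ ih =>
    intro e x hM b
    obtain ⟨b', h'⟩ := ih _ _ (fun l => hM (some (Sum.inr l))) b
    exact ⟨b', (Steps.one (hM none) (by simp [code, hb])).trans h'⟩
  | empty hk _ ih =>
    intro e x hM b
    obtain ⟨b', h'⟩ := ih _ _ (fun l => hM (some (Sum.inl l))) true
    exact ⟨b', (Steps.one (hM none) (by simp [code, hk])).trans h'⟩
  | @nonempty k p q s S _ _ _ hk _ ih =>
    intro e x hM b
    obtain ⟨b', h'⟩ := ih _ _ (fun l => hM (some (Sum.inr l))) false
    obtain ⟨a, l, hl⟩ := List.exists_cons_of_ne_nil hk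
    exact ⟨b', (Steps.one (hM none) (by simp [code, hl])).trans h'⟩
  | @drain_nil k f p s S hk =>
    intro e x hM b
    refine ⟨false, Steps.one (hM none) ?_⟩
    -- The unsuccessful `pop` that ends the loop writes back the tail of an empty stack.
    have : Function.update S k [] = S := by rw [← hk, Function.update_eq_self]
    simp [code, hk, this]
  | drain_cons hk _ _ ih ih' =>
    intro e x hM b
    obtain ⟨b', h'⟩ := ih _ _ (fun l => hM (some l)) true
    obtain ⟨b'', h''⟩ := ih' e x hM b'
    exact ⟨b'', (Steps.one (hM none) (by simp [code, hk])).trans (h'.trans h'')⟩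

/-- The Turing machine that executes a program, with stack `k₀` for the input and `k₁` for the
output, and resets its internal state at the end. -/
noncomputable def machine [Fintype K] [Finite σ] (k₀ k₁ : K) [Fintype (Γ k₀)] (s₀ : σ)
    (p : Prog Γ σ) : Turing.FinTM2 :=
  { K := K
    k₀ := k₀
    k₁ := k₁
    Γ := Γ
    Λ := Option p.Label
    main := some p.entry
    ΛFin := Fintype.ofFinite _
    σ := σ × Bool
    initialState := (s₀, false)
    σFin := Fintype.ofFinite _
    m := fun l => l.elim (.load (fun _ => (s₀, false)) .halt) (p.code some none) }

theorem Exec.outputs [Fintype K] [Finite σ] {k₀ k₁ : K} [Fintype (Γ k₀)] {s₀ : σ}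
    {p : Prog Γ σ} {n m : ℕ} {s' : σ} {S S' : ∀ k, List (Γ k)} {i : List (Γ k₀)}
    {o : List (Γ k₁)} (h : Exec p s₀ S n s' S') (hS : S = Function.update (fun _ => []) k₀ i)
    (hS' : S' = Function.update (fun _ => []) k₁ o) (hm : n + 1 ≤ m) :
    Nonempty (Turing.TM2OutputsInTime (machine k₀ k₁ s₀ p) i (some o) m) := by
  obtain ⟨b, hb⟩ := h.steps (machine k₀ k₁ s₀ p).m some none (fun _ => rfl) false
  -- One additional step restores the initial state, which `Turing.haltList` demands.
  have h₂ : Steps (machine k₀ k₁ s₀ p).m 1 ⟨some none, (s', b), S'⟩ ⟨none, (s₀, false), S'⟩ := rfl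
  have h₃ := hb.trans h₂
  have hi : Turing.initList (machine k₀ k₁ s₀ p) i = ⟨some (some p.entry), (s₀, false), S⟩ := by
    rw [hS]
    unfold Turing.initList
    congr 1
    refine funext fun (k : K) => ?_
    by_cases hk : k = k₀
    · cases hk
      exact (dif_pos rfl).trans
        (Function.update_self (f := fun k => ([] : List (Γ k))) k₀ i).symm
    · have h₄ : Function.update (fun k => ([] : List (Γ k))) k₀ i k = [] :=
        Function.update_of_ne hk _ _
      exact (dif_neg hk).trans h₄.symm
  have ho : Turing.haltList (machine k₀ k₁ s₀ p) o = ⟨none, (s₀, false), S'⟩ := by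
    rw [hS']
    unfold Turing.haltList
    congr 1
    refine funext fun (k : K) => ?_
    by_cases hk : k = k₁
    · cases hk
      exact (dif_pos rfl).trans
        (Function.update_self (f := fun k => ([] : List (Γ k))) k₁ o).symm
    · have h₄ : Function.update (fun k => ([] : List (Γ k))) k₁ o k = [] :=
        Function.update_of_ne hk _ _
      exact (dif_neg hk).trans h₄.symm
  refine ⟨⟨⟨n + 1, ?_⟩, hm⟩⟩
  rw [hi]
  exact Eq.trans h₃ (congrArg some ho.symm)

end Prog

/-! ### Counter programs with loops over the input -/

/-- The stacks of a machine with counters `C` and loops `I`. -/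
inductive StackName (C I : Type) : Type
  | input | output | aux
  | ctr (c : C)
  | left (i : I)
  | right (i : I)
  deriving DecidableEq, Fintype

/-- The alphabet of each stack. -/
abbrev StackName.Letter {C I : Type} : StackName C I → Type
  | input => Γ'
  | output => Bool
  | aux => Γ'
  | ctr _ => Unit
  | left _ => Γ'
  | right _ => Γ'

/-- Programs that work on an internal state and on counters.  The body of the loop `forIn i f p` is
executed once for each letter of the input; the letter is absorbed into the internal state
by `f`.  Nested loops must have different names. -/
inductive Cmd (C I σ : Type) : Type
  | inc (c : C) : Cmd C I σ
  | dec (c : C) : Cmd C I σ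
  | set (f : σ → σ) : Cmd C I σ
  | seq (p q : Cmd C I σ) : Cmd C I σ
  | ite (b : σ → Bool) (p q : Cmd C I σ) : Cmd C I σ
  | ifz (c : C) (p q : Cmd C I σ) : Cmd C I σ
  | forIn (i : I) (f : Γ' → σ → σ) (p : Cmd C I σ) : Cmd C I σ

namespace Cmd

variable {C I σ : Type} [DecidableEq C]

/-- The effect of a program on the internal state and the counters, for the input `w`. -/
def run (w : List Γ') : Cmd C I σ → σ × (C → ℕ) → σ × (C → ℕ)
  | inc c, s => (s.1, Function.update s.2 c (s.2 c + 1))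
  | dec c, s => (s.1, Function.update s.2 c (s.2 c - 1))
  | set f, s => (f s.1, s.2)
  | seq p q, s => q.run w (p.run w s)
  | ite b p q, s => if b s.1 then p.run w s else q.run w s
  | ifz c p q, s => if s.2 c = 0 then p.run w s else q.run w s
  | forIn _ f p, s => w.foldl (fun s a => p.run w (f a s.1, s.2)) s

/-- The names of the loops of a program. -/
def loops : Cmd C I σ → Set I
  | inc _ => ∅
  | dec _ => ∅
  | set _ => ∅
  | seq p q => p.loops ∪ q.loops
  | ite _ p q => p.loops ∪ q.loops
  | ifz _ p q => p.loops ∪ q.loops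
  | forIn i _ p => insert i p.loops

/-- Nested loops have different names. -/
def WF : Cmd C I σ → Prop
  | inc _ => True
  | dec _ => True
  | set _ => True
  | seq p q => p.WF ∧ q.WF
  | ite _ p q => p.WF ∧ q.WF
  | ifz _ p q => p.WF ∧ q.WF
  | forIn i _ p => i ∉ p.loops ∧ p.WF

/-- A bound for the running time, as a polynomial in the length of the input. -/
noncomputable def time : Cmd C I σ → Polynomial ℕ
  | inc _ => 1
  | dec _ => 1
  | set _ => 1
  | seq p q => p.time + q.time
  | ite _ p q => 1 + (p.time + q.time)
  | ifz _ p q => 1 + (p.time + q.time)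
  | forIn _ _ p => Polynomial.X * (p.time + 4) + 2

/-- The translation into programs for stacks.  The additional component of the internal state holds
the letter that is moved.  A counter is a stack whose height is the value of the counter, and
each loop has its own copy of the input, which is split between a left and a right stack. -/
def toProg : Cmd C I σ → Prog (StackName.Letter (C := C) (I := I)) (σ × Γ')
  | inc c => .push (.ctr c) fun _ => ()
  | dec c => .pop (.ctr c)
  | set f => .load fun s => (f s.1, s.2)
  | seq p q => .seq p.toProg q.toProg
  | ite b p q => .ite (fun s => b s.1) p.toProg q.toProg
  | ifz c p q => .ifEmpty (.ctr c) p.toProg q.toProg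
  | forIn i f p =>
    .seq (.drain (.right i) (fun a s => (f a s.1, a)) (.seq (.push (.left i) fun s => s.2) p.toProg))
      (.drain (.left i) (fun a s => (s.1, a)) (.push (.right i) fun s => s.2))

/-- The stacks with given contents. -/
def content (i a : List Γ') (o : List Bool) (c : C → ℕ) (L R : I → List Γ') :
    ∀ k : StackName C I, List k.Letter
  | .input => i
  | .output => o
  | .aux => a
  | .ctr x => List.replicate (c x) ()
  | .left x => L x
  | .right x => R x

section

variable {i a : List Γ'} {o : List Bool} {c : C → ℕ} {L R : I → List Γ'} [DecidableEq I]

theorem update_input (l : List Γ') : Function.update (content i a o c L R) .input l =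
    content l a o c L R := by
  funext k
  cases k <;> simp [content, Function.update]

theorem update_aux (l : List Γ') : Function.update (content i a o c L R) .aux l =
    content i l o c L R := by
  funext k
  cases k <;> simp [content, Function.update]

theorem update_output (l : List Bool) : Function.update (content i a o c L R) .output l =
    content i a l c L R := by
  funext k
  cases k <;> simp [content, Function.update]

theorem update_ctr (x : C) (n : ℕ) :
    Function.update (content i a o c L R) (.ctr x) (List.replicate n ()) =
    content i a o (Function.update c x n) L R := by
  funext k
  cases k with
  | ctr y =>
    by_cases h : y = x
    · subst h; simp [content]
    · rw [Function.update_of_ne (by simpa using h)]; simp [content, h]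
  | _ => rw [Function.update_of_ne (by simp)]; simp [content]

theorem update_left (x : I) (l : List Γ') :
    Function.update (content i a o c L R) (.left x) l =
    content i a o c (Function.update L x l) R := by
  funext k
  cases k with
  | left y =>
    by_cases h : y = x
    · subst h; simp [content]
    · rw [Function.update_of_ne (by simpa using h)]; simp [content, h]
  | _ => rw [Function.update_of_ne (by simp)]; simp [content]

theorem update_right (x : I) (l : List Γ') :
    Function.update (content i a o c L R) (.right x) l =
    content i a o c L (Function.update R x l) := by
  funext k
  cases k with
  | right y =>
    by_cases h : y = x
    · subst h; simp [content]
    · rw [Function.update_of_ne (by simpa using h)]; simp [content, h]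
  | _ => rw [Function.update_of_ne (by simp)]; simp [content]

end

variable [DecidableEq I]

/-- After a loop, its left stack holds the input reversed; pouring it back makes the loop ready for
its next execution. -/
theorem exec_rewind (i a : List Γ') (o : List Bool) (c : C → ℕ) (x : I) (s : σ) :
    ∀ (l : List Γ') (L R : I → List Γ') (g : Γ'), L x = l →
    ∃ g', Prog.Exec (.drain (.left x) (fun a s => (s.1, a)) (.push (.right x) fun s => s.2))
      (s, g) (content i a o c L R) (l.length * 2 + 1) (s, g')
      (content i a o c (Function.update L x []) (Function.update R x (l.reverse ++ R x))) := by
  intro l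
  induction l with
  | nil =>
    intro L R g hL
    refine ⟨g, ?_⟩
    simp only [List.reverse_nil, List.nil_append, Function.update_eq_self, List.length_nil]
    rw [← hL, Function.update_eq_self]
    exact .drain_nil hL
  | cons b l ih =>
    intro L R g hL
    obtain ⟨g', h⟩ := ih (Function.update L x l) (Function.update R x (b :: R x)) b (by simp)
    refine ⟨g', ?_⟩
    have := Prog.Exec.drain_cons (k := StackName.left x) (f := fun a s => (s.1, a))
      (p := .push (.right x) fun s => s.2)
      (S := content i a o c L R) (s := (s, g)) (a := b) (l := l) hL .push
      (by rw [update_left, update_right]; exact h)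
    convert this using 1
    · simp; ring
    · simp

/-- Before and after `p`, each loop of `p` is rewound. Nothing is required of the stacks of other
loops, so the body of a loop can run while the copy of the input for the enclosing loop is split. A
loop spends four steps per letter besides its body, two forwards and two for rewinding, and one step
at the end of each pass. -/
theorem exec_toProg (w i a : List Γ') (o : List Bool) : ∀ (p : Cmd C I σ), p.WF →
    ∀ (L R : I → List Γ'), (∀ x ∈ p.loops, L x = [] ∧ R x = w) → ∀ (s : σ × (C → ℕ)) (g : Γ'),
    ∃ n ≤ p.time.eval w.length, ∃ g', Prog.Exec p.toProg (s.1, g) (content i a o s.2 L R) n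
      ((p.run w s).1, g') (content i a o (p.run w s).2 L R) := by
  intro p
  induction p with
  | inc x =>
    intro _ L R _ s g
    refine ⟨1, by simp [time], g, ?_⟩
    simp only [run, ← update_ctr]
    exact .push
  | dec x =>
    intro _ L R _ s g
    refine ⟨1, by simp [time], g, ?_⟩
    simp only [run, ← update_ctr]
    have : List.replicate (s.2 x - 1) () = (content i a o s.2 L R (.ctr x)).tail := by
      simp [content]
    rw [this]
    exact .pop
  | set f =>
    intro _ L R _ s g
    exact ⟨1, by simp [time], g, .load⟩
  | seq p q ihp ihq =>
    intro h L R hL s g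
    obtain ⟨n, hn, g', h₁⟩ := ihp h.1 L R (fun x hx => hL x (Or.inl hx)) s g
    obtain ⟨m, hm, g'', h₂⟩ := ihq h.2 L R (fun x hx => hL x (Or.inr hx)) (p.run w s) g'
    exact ⟨n + m, by simp only [time, Polynomial.eval_add]; omega, g'', .seq h₁ h₂⟩
  | ite b p q ihp ihq =>
    intro h L R hL s g
    obtain ⟨n, hn, g', h₁⟩ := ihp h.1 L R (fun x hx => hL x (Or.inl hx)) s g
    obtain ⟨m, hm, g'', h₂⟩ := ihq h.2 L R (fun x hx => hL x (Or.inr hx)) s g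
    have ht : (ite b p q : Cmd C I σ).time.eval w.length =
        1 + (p.time.eval w.length + q.time.eval w.length) := by simp [time]
    cases hb : b s.1
    · refine ⟨1 + m, by omega, g'', ?_⟩
      simp only [run, hb]
      exact .ite_false hb h₂
    · refine ⟨1 + n, by omega, g', ?_⟩
      simp only [run, hb]
      exact .ite_true hb h₁
  | ifz x p q ihp ihq =>
    intro h L R hL s g
    obtain ⟨n, hn, g', h₁⟩ := ihp h.1 L R (fun x hx => hL x (Or.inl hx)) s g
    obtain ⟨m, hm, g'', h₂⟩ := ihq h.2 L R (fun x hx => hL x (Or.inr hx)) s g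
    have ht : (ifz x p q : Cmd C I σ).time.eval w.length =
        1 + (p.time.eval w.length + q.time.eval w.length) := by simp [time]
    by_cases hx : s.2 x = 0
    · refine ⟨1 + n, by omega, g', ?_⟩
      simp only [run, hx, if_true]
      exact .empty (by simp [content, hx]) h₁
    · refine ⟨1 + m, by omega, g'', ?_⟩
      simp only [run, hx, if_false]
      exact .nonempty (by simpa [content] using hx) h₂
  | forIn x f p ih =>
    intro h L R hL s g
    -- Here `r` is the unread part of the input and `l` the part read so far, in reverse.
    have key : ∀ (r l : List Γ') (s : σ × (C → ℕ)) (g : Γ'),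
        ∃ n ≤ r.length * (p.time.eval w.length + 2) + 1, ∃ g',
        Prog.Exec (.drain (.right x) (fun a s => (f a s.1, a))
          (.seq (.push (.left x) fun s => s.2) p.toProg)) (s.1, g)
          (content i a o s.2 (Function.update L x l) (Function.update R x r)) n
          ((r.foldl (fun s a => p.run w (f a s.1, s.2)) s).1, g')
          (content i a o (r.foldl (fun s a => p.run w (f a s.1, s.2)) s).2
            (Function.update L x (r.reverse ++ l)) (Function.update R x [])) := by
      intro r
      induction r with
      | nil => intro l s g; exact ⟨1, by simp, g, .drain_nil (by simp [content])⟩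
      | cons b r ihr =>
        intro l s g
        obtain ⟨n, hn, g', h₁⟩ := ih h.2 (Function.update L x (b :: l)) (Function.update R x r)
          (fun y hy => by
            have : y ≠ x := fun e => h.1 (e ▸ hy)
            simpa [this] using hL y (Or.inr hy)) (f b s.1, s.2) b
        obtain ⟨m, hm, g'', h₂⟩ := ihr (b :: l) (p.run w (f b s.1, s.2)) g'
        refine ⟨1 + ((1 + n) + m), ?_, g'', ?_⟩
        · simp only [List.length_cons, Nat.add_mul, one_mul]; omega
        · refine .drain_cons (a := b) (l := r) (by simp [content])
            (.seq .push (n := 1) (m := n) ?_) ?_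
            (s' := ((p.run w (f b s.1, s.2)).1, g'))
            (S' := content i a o (p.run w (f b s.1, s.2)).2 (Function.update L x (b :: l))
              (Function.update R x r))
          · rw [update_right, update_left]
            simpa [content] using h₁
          · simpa using h₂
    have hx := hL x (Or.inl rfl)
    obtain ⟨n, hn, g', h₁⟩ := key w [] s g
    obtain ⟨g'', h₂⟩ := exec_rewind i a o ((forIn x f p).run w s).2 x ((forIn x f p).run w s).1
      w.reverse (Function.update L x w.reverse) (Function.update R x []) g' (by simp)
    refine ⟨n + (w.reverse.length * 2 + 1), ?_, g'', ?_⟩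
    · simp only [time, Polynomial.eval_add, Polynomial.eval_mul, Polynomial.eval_X,
        List.length_reverse, Polynomial.eval_ofNat, Nat.mul_add] at hn ⊢
      omega
    · have eL : Function.update L x [] = L := by rw [← hx.1, Function.update_eq_self]
      have eR : Function.update R x w = R := by rw [← hx.2, Function.update_eq_self]
      simp only [List.append_nil, eL, eR] at h₁
      simp only [List.reverse_reverse, Function.update_idem, Function.update_self,
        List.append_nil, eL, eR] at h₂
      exact .seq h₁ h₂

end Cmd

/-! ### Supplying the loops with the input, and cleaning up -/

namespace Cmd

variable {C I σ : Type} [DecidableEq C] [DecidableEq I]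

/-- Push the letter in memory on the right stacks of all loops in a list. -/
def pushAll (C σ : Type) (l : List I) : Prog (StackName.Letter (C := C) (I := I)) (σ × Γ') :=
  l.foldr (fun x p => .seq (.push (.right x) fun s => s.2) p) (.load id)

/-- Empty the right stacks of all loops in a list. -/
def clearAll (C σ : Type) (l : List I) : Prog (StackName.Letter (C := C) (I := I)) (σ × Γ') :=
  l.foldr (fun x p => .seq (.drain (.right x) (fun _ s => s) (.load id)) p) (.load id)

theorem exec_pushAll (i a : List Γ') (o : List Bool) (c : C → ℕ) (L : I → List Γ') (s : σ)
    (b : Γ') : ∀ (l : List I), l.Nodup → ∀ R : I → List Γ',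
    Prog.Exec (pushAll C σ l) (s, b) (content i a o c L R) (l.length + 1) (s, b)
      (content i a o c L fun x => if x ∈ l then b :: R x else R x) := by
  intro l
  induction l with
  | nil => intro _ R; simpa using! Prog.Exec.load (f := id)
  | cons x l ih =>
    intro hl R
    rw [List.nodup_cons] at hl
    have h := ih hl.2 (Function.update R x (b :: R x))
    rw [← update_right] at h
    have h₂ := Prog.Exec.seq (Prog.Exec.push (k := StackName.right x) (f := fun s => s.2)
      (s := (s, b)) (S := content i a o c L R)) h
    rw [List.length_cons, Nat.add_comm l.length 1, Nat.add_assoc]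
    convert! h₂ using 2
    funext y
    by_cases hy : y = x
    · subst hy; simp [hl.1]
    · simp [hy]

theorem exec_clear (i a : List Γ') (o : List Bool) (c : C → ℕ) (L : I → List Γ') (s : σ × Γ')
    (x : I) : ∀ (l : List Γ') (R : I → List Γ'), R x = l →
    Prog.Exec (.drain (.right x) (fun _ s => s) (.load id)) s (content i a o c L R)
      (2 * l.length + 1) s (content i a o c L (Function.update R x [])) := by
  intro l
  induction l with
  | nil =>
    intro R hR
    have e : Function.update R x [] = R := by rw [← hR, Function.update_eq_self]
    rw [e]
    exact .drain_nil hR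
  | cons b l ih =>
    intro R hR
    have h := ih (Function.update R x l) (by simp)
    rw [Function.update_idem] at h
    have h₂ := Prog.Exec.drain_cons (k := StackName.right x) (f := fun _ s => s)
      (S := content i a o c L R) (s := s) (a := b) (l := l) hR .load
      (by rw [update_right]; exact h)
    convert! h₂ using 1
    simp; ring

theorem exec_clearAll (i a : List Γ') (o : List Bool) (c : C → ℕ) (L : I → List Γ') (s : σ × Γ')
    (N : ℕ) : ∀ (l : List I) (R : I → List Γ'), (∀ x, (R x).length ≤ N) →
    ∃ n ≤ l.length * (2 * N + 1) + 1,
    Prog.Exec (clearAll C σ l) s (content i a o c L R) n s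
      (content i a o c L fun x => if x ∈ l then [] else R x) := by
  intro l
  induction l with
  | nil => intro R _; exact ⟨1, by simp, by simpa using! Prog.Exec.load (f := id)⟩
  | cons x l ih =>
    intro R hR
    obtain ⟨n, hn, h⟩ := ih (Function.update R x []) (fun y => by
      by_cases hy : y = x
      · subst hy; simp
      · simpa [hy] using hR y)
    refine ⟨2 * (R x).length + 1 + n, ?_, ?_⟩
    · have := hR x
      rw [List.length_cons, Nat.add_mul]
      omega
    · have h₂ := Prog.Exec.seq (exec_clear i a o c L s x (R x) R rfl) h
      convert! h₂ using 2
      funext y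
      by_cases hy : y = x
      · subst hy; simp
      · simp [hy]

theorem exec_reverse (o : List Bool) (c : C → ℕ) (L R : I → List Γ') (s : σ) :
    ∀ (i a : List Γ') (g : Γ'), ∃ g',
    Prog.Exec (.drain .input (fun a s => (s.1, a)) (.push .aux fun s => s.2))
      (s, g) (content i a o c L R) (i.length * 2 + 1) (s, g')
      (content [] (i.reverse ++ a) o c L R) := by
  intro i
  induction i with
  | nil => intro a g; exact ⟨g, .drain_nil rfl⟩
  | cons b i ih =>
    intro a g
    obtain ⟨g', h⟩ := ih (b :: a) b
    refine ⟨g', ?_⟩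
    have := Prog.Exec.drain_cons (k := StackName.input) (f := fun a s => (s.1, a))
      (p := .push .aux fun s => s.2)
      (S := content (b :: i) a o c L R) (s := (s, g)) (a := b) (l := i) rfl .push
      (by rw [update_input, update_aux]; exact h)
    convert! this using 1
    · simp; ring
    · simp

/-- The auxiliary stack holds the input reversed, and emptying it reverses once more, so every loop
receives the input in its original order. -/
theorem exec_distribute [Fintype I] (i : List Γ') (o : List Bool) (c : C → ℕ) (L : I → List Γ')
    (s : σ) : ∀ (a r : List Γ') (g : Γ'), ∃ g',
    Prog.Exec (.drain .aux (fun a s => (s.1, a)) (pushAll C σ (Finset.univ : Finset I).toList))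
      (s, g) (content i a o c L fun _ => r) (a.length * (Fintype.card I + 2) + 1) (s, g')
      (content i [] o c L fun _ => a.reverse ++ r) := by
  intro a
  induction a with
  | nil => intro r g; exact ⟨g, by simpa using Prog.Exec.drain_nil rfl⟩
  | cons b a ih =>
    intro r g
    obtain ⟨g', h⟩ := ih (b :: r) b
    refine ⟨g', ?_⟩
    have h₁ := exec_pushAll i a o c L s b (Finset.univ : Finset I).toList
      (Finset.nodup_toList _) fun _ => r
    simp only [Finset.mem_toList, Finset.mem_univ, if_true, Finset.length_toList,
      Finset.card_univ] at h₁
    rw [← update_aux (a := b :: a)] at h₁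
    have := Prog.Exec.drain_cons (k := StackName.aux) (f := fun a s => (s.1, a))
      (S := content i (b :: a) o c L fun _ => r) (s := (s, g)) (a := b) (l := a) rfl h₁ h
    convert! this using 1
    · simp only [List.length_cons]; ring
    · simp

theorem content_eq_update_input (w : List Γ') :
    (content w [] [] (fun _ => 0) (fun _ => []) fun _ => [] :
      ∀ k : StackName C I, List k.Letter) = 
      Function.update (fun k : StackName C I => ([] : List k.Letter)) .input w := by
  funext k
  cases k <;> simp [content, Function.update]

theorem content_eq_update_output (o : List Bool) :
    (content [] [] o (fun _ => 0) (fun _ => []) fun _ => [] :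
      ∀ k : StackName C I, List k.Letter) = 
      Function.update (fun k : StackName C I => ([] : List k.Letter)) .output o := by
  funext k
  cases k <;> simp [content, Function.update]

/-- A program that answers a question, and leaves its counters empty, shows that the question is
decidable in polynomial time. -/
theorem polyTimeDecidable [Fintype C] [Fintype I] [Finite σ] {α : Type} {enc : α → List Γ'}
    {P : α → Prop} (p : Cmd C I σ) (hp : p.WF) (s₀ : σ) (res : σ → Bool)
    (hc : ∀ a, (p.run (enc a) (s₀, fun _ => 0)).2 = fun _ => 0)
    (hres : ∀ a, res (p.run (enc a) (s₀, fun _ => 0)).1 = true ↔ P a) :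
    PolyTimeDecidable enc P := by
  refine ⟨fun a => res (p.run (enc a) (s₀, fun _ => 0)).1, hres, ?_⟩
  let l := (Finset.univ : Finset I).toList
  let q : Prog (StackName.Letter (C := C) (I := I)) (σ × Γ') :=
    .seq (.seq (.drain .input (fun a s => (s.1, a)) (.push .aux fun s => s.2))
      (.drain .aux (fun a s => (s.1, a)) (pushAll C σ l)))
      (.seq p.toProg (.seq (.push .output fun s => res s.1) (clearAll C σ l)))
  have : Fintype (StackName.Letter (C := C) (I := I) .input) := inferInstanceAs (Fintype Γ')
  -- The summands account for reversing the input, distributing it, the program itself, and emptying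
  -- the copies. The constant 5 consists of the final steps of the first two loops and of the
  -- cleaning, the output of the answer, and the reset of the state.
  let m : Polynomial ℕ := Polynomial.X * 2 + Polynomial.X * ((Fintype.card I + 2 : ℕ) : Polynomial ℕ) +
    p.time + ((Fintype.card I : ℕ) : Polynomial ℕ) * (2 * Polynomial.X + 1) + 5
  have key : ∀ a, Nonempty (Turing.TM2OutputsInTime
      (Prog.machine StackName.input StackName.output (s₀, Γ'.blank) q) (enc a)
      (some [res (p.run (enc a) (s₀, fun _ => 0)).1]) (m.eval (enc a).length)) := by
    intro a
    obtain ⟨g₁, h₁⟩ := exec_reverse (C := C) (I := I) [] (fun _ => 0) (fun _ => [])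
      (fun _ => []) s₀ (enc a) [] Γ'.blank
    obtain ⟨g₂, h₂⟩ := exec_distribute (C := C) (I := I) [] [] (fun _ => 0) (fun _ => [])
      s₀ (enc a).reverse [] g₁
    obtain ⟨n, hn, g₃, h₃⟩ := exec_toProg (enc a) [] [] [] p hp (fun _ => []) (fun _ => enc a)
      (fun _ _ => ⟨rfl, rfl⟩) (s₀, fun _ => 0) g₂
    obtain ⟨k, hk, h₄⟩ := exec_clearAll (C := C) (I := I) [] []
      [res (p.run (enc a) (s₀, fun _ => 0)).1] (fun _ => 0) (fun _ => [])
      ((p.run (enc a) (s₀, fun _ => 0)).1, g₃) (enc a).length l (fun _ => enc a) fun _ => le_rfl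
    rw [hc] at h₃
    simp only [List.reverse_reverse, List.append_nil] at h₁ h₂
    rw [← update_output (o := [])] at h₄
    have h := (h₁.seq h₂).seq (h₃.seq (Prog.Exec.seq
      (.push (k := StackName.output) (f := fun s => res s.1)) h₄))
    refine h.outputs (content_eq_update_input _) ?_ ?_
    · refine Eq.trans ?_ (content_eq_update_output _)
      simp [l]
      rfl
    · simp only [m, Polynomial.eval_add, Polynomial.eval_mul, Polynomial.eval_X,
        Polynomial.eval_natCast, Polynomial.eval_ofNat, Polynomial.eval_one, List.length_reverse,
        Nat.cast_id]
      simp only [l, Finset.length_toList, Finset.card_univ] at hk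
      omega
  exact ⟨{
    tm := Prog.machine StackName.input StackName.output (s₀, Γ'.blank) q
    inputAlphabet := Equiv.refl _
    outputAlphabet := Equiv.refl _
    time := m
    outputsFun := fun a => by
      have h := (key a).some
      refine cast ?_ h
      congr 1
      · exact (List.map_id _).symm }⟩

end Cmd

/-! ### Formulas about instances, and programs that evaluate them -/

/-- What a counting formula says about the numbers of the tokens of the initial and of the target
configuration. -/
inductive CountTest : Type
  | same | three | someS | someT

/-- The meaning of a test. -/
def CountTest.Holds : CountTest → ℕ → ℕ → Prop
  | same, s, t => s = t
  | three, s, _ => 3 ≤ s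
  | someS, s, _ => 1 ≤ s
  | someT, _, t => 1 ≤ t

/-- First order formulas about graphs, with variables in `X`, together with formulas `count o x φ`
that compare the numbers of the tokens on the vertices `x` with `φ`. -/
inductive Formula (X : Type) : Type
  | eq (x y : X) : Formula X
  | adj (x y : X) : Formula X
  | neg (φ : Formula X) : Formula X
  | and (φ ψ : Formula X) : Formula X
  | all (x : X) (φ : Formula X) : Formula X
  | count (o : CountTest) (x : X) (φ : Formula X) : Formula X

namespace Formula

variable {X : Type} [DecidableEq X]

open Classical in
/-- The meaning of a formula. -/
def Eval (I : DSRInstance) : Formula X → (X → Fin I.n) → Prop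
  | eq x y, e => e x = e y
  | adj x y, e => I.G.Adj (e x) (e y)
  | neg φ, e => ¬ φ.Eval I e
  | and φ ψ, e => φ.Eval I e ∧ ψ.Eval I e
  | all x φ, e => ∀ v, φ.Eval I (Function.update e x v)
  | count o x φ, e => o.Holds (I.Ds.countP fun v => φ.Eval I (Function.update e x v))
      (I.Dt.countP fun v => φ.Eval I (Function.update e x v))

/-- The bound variables of a formula. -/
def bound : Formula X → List X
  | eq _ _ => []
  | adj _ _ => []
  | neg φ => φ.bound
  | and φ ψ => φ.bound ++ ψ.bound
  | all x φ => x :: φ.bound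
  | count _ x φ => x :: φ.bound

/-- No variable is bound again in the scope of a quantifier. -/
def wf : Formula X → Bool
  | eq _ _ => true
  | adj _ _ => true
  | neg φ => φ.wf
  | and φ ψ => φ.wf && ψ.wf
  | all x φ => decide (x ∉ φ.bound) && φ.wf
  | count _ x φ => decide (x ∉ φ.bound) && φ.wf

end Formula

/-- The counters of a program that evaluates a formula: the values of the variables, the numbers of
tokens found, and three auxiliary counters. -/
inductive Ctr (X : Type) : Type
  | var (x : X)
  | tokS (x : X)
  | tokT (x : X)
  | fst | snd | tmp
  deriving DecidableEq, Fintype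

/-- The internal state of a program that evaluates a formula: the result, the state and the letter
of a scan of the input, and, for each variable, a bit that tells whether the loop for this variable
is still in the first row of the adjacency matrix. -/
@[ext]
structure Flags (X : Type) : Type where
  res : Bool
  phase : Fin 5
  letter : Γ'
  live : X → Bool

instance {X : Type} [Finite X] : Finite (Flags X) :=
  Finite.of_injective (fun s => (s.res, s.phase, s.letter, s.live)) fun s t h => by
    simp only [Prod.mk.injEq] at h
    exact Flags.ext h.1 h.2.1 h.2.2.1 h.2.2.2

/-- Programs that evaluate formulas. -/
abbrev FCmd (X : Type) : Type := Cmd (Ctr X) (Option X) (Flags X)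

namespace FCmd

open Cmd

variable {X : Type}

/-- Do nothing. -/
def skip : FCmd X := .set id

/-- Execute a program as often as there are letters in the input. -/
def rep (p : FCmd X) : FCmd X := .forIn none (fun _ s => s) p

/-- Set a counter to zero. -/
def clear (c : Ctr X) : FCmd X := rep (.dec c)

/-- Add a counter to another one. -/
def copy (c d : Ctr X) : FCmd X :=
  .seq (rep (.ifz c skip (.seq (.dec c) (.seq (.inc d) (.inc .tmp)))))
    (rep (.ifz .tmp skip (.seq (.dec .tmp) (.inc c))))

/-- Set the result. -/
def answer (b : Bool) : FCmd X := .set fun s => { s with res := b }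

/-- Test whether two counters are equal, and clear them. -/
def compare (c d : Ctr X) : FCmd X :=
  .seq (rep (.ifz c skip (.ifz d skip (.seq (.dec c) (.dec d)))))
    (.seq (.ifz c (.ifz d (answer true) (answer false)) (answer false))
      (.seq (clear c) (clear d)))

/-- Scan the input. -/
def scan (p : FCmd X) : FCmd X :=
  .seq (.forIn none (fun a s => { s with letter := a })
    (.seq p (.set fun s => { s with letter := .blank }))) (.set fun s => { s with phase := 0 })

/-- The step of a scan that looks up the entry of the adjacency matrix in the row `fst` and the
column `snd`. -/
def lookupStep : FCmd X :=
  .ite (fun s => s.phase = 0)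
    (.ifz .fst
      (.ifz .snd (.set fun s => { s with phase := 1, res := s.letter = .bit true }) (.dec .snd))
      (.ite (fun s => s.letter = .comma) (.dec .fst) skip)) skip

/-- The step of a scan that adds the length of the word with the number `c` to `k`. -/
def lengthStep (c k : Ctr X) (q : Fin 5) : FCmd X :=
  .ite (fun s => s.letter = .comma)
    (.ifz c (.set fun s => { s with phase := q }) (.dec c)) (.ifz c (.inc k) skip)

/-- The step of a scan that adds the numbers of tokens on the vertex `fst = snd` to the counters
for the tokens. -/
def tokenStep (x : X) : FCmd X :=
  .ite (fun s => s.letter = .ket)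
    (.set fun s => { s with phase := if s.phase = 0 then 1 else if s.phase = 2 then 3 else s.phase })
    (.ite (fun s => s.phase = 1) (lengthStep .fst (.tokS x) 2)
      (.ite (fun s => s.phase = 3) (lengthStep .snd (.tokT x) 4) skip))

variable [DecidableEq X]

/-- Whether a letter is a bit. -/
def isBit : Γ' → Bool
  | .bit _ => true
  | _ => false

/-- Execute `p` for all values of the variable `x`. -/
def forVertices (x : X) (p : FCmd X) : FCmd X :=
  .seq (.forIn (some x)
    (fun a s => { s with live := Function.update s.live x (s.live x && isBit a) })
    (.ite (fun s => s.live x) (.seq p (.inc (.var x))) skip))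
    (.seq (.set fun s => { s with live := Function.update s.live x true }) (clear (.var x)))

/-- Evaluate a test on the counters for the tokens, and clear them. -/
def test (x : X) : CountTest → FCmd X
  | .same => compare (.tokS x) (.tokT x)
  | .three => .seq (.dec (.tokS x)) (.seq (.dec (.tokS x))
      (.seq (.ifz (.tokS x) (answer false) (answer true))
        (.seq (clear (.tokS x)) (clear (.tokT x)))))
  | .someS => .seq (.ifz (.tokS x) (answer false) (answer true))
      (.seq (clear (.tokS x)) (clear (.tokT x)))
  | .someT => .seq (.ifz (.tokT x) (answer false) (answer true))
      (.seq (clear (.tokS x)) (clear (.tokT x)))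

/-- The program that evaluates a formula. -/
def eval : Formula X → FCmd X
  | .eq x y => .seq (copy (.var x) .fst) (.seq (copy (.var y) .snd) (compare .fst .snd))
  | .adj x y => .seq (copy (.var x) .fst) (.seq (copy (.var y) .snd) (scan lookupStep))
  | .neg φ => .seq (eval φ) (.set fun s => { s with res := !s.res })
  | .and φ ψ => .seq (eval φ) (.ite (fun s => s.res) (eval ψ) skip)
  | .all x φ => .seq (answer true) (forVertices x (.ite (fun s => s.res) (eval φ) skip))
  | .count o x φ => .seq (answer false) (.seq
      (forVertices x (.seq (eval φ) (.seq (.ite (fun s => s.res)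
        (.seq (copy (.var x) .fst) (.seq (copy (.var x) .snd) (scan (tokenStep x)))) skip)
        (answer false))))
      (test x o))

/-! #### The loops of the programs -/

theorem loops_eval (φ : Formula X) : ∀ x, some x ∈ (eval φ).loops → x ∈ φ.bound := by
  induction φ with
  | eq x y => simp [eval, loops, copy, rep, compare, skip, answer, clear]
  | adj x y => simp [eval, loops, copy, rep, scan, skip, lookupStep]
  | neg φ ih => simpa [eval, loops, Formula.bound] using ih
  | and φ ψ ih ih' =>
    intro x hx
    simp only [eval, loops, skip, Set.mem_union, Set.mem_empty_iff_false, or_false] at hx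
    simp only [Formula.bound, List.mem_append]
    exact hx.imp (ih x) (ih' x)
  | all y φ ih =>
    intro x hx
    simp [eval, loops, skip, answer, forVertices, clear, rep] at hx
    simp only [Formula.bound, List.mem_cons]
    exact hx.imp id (ih x)
  | count o y φ ih =>
    intro x hx
    have : some x ∉ (test y o).loops := by
      cases o <;> simp [test, compare, loops, rep, skip, answer, clear]
    simp [eval, loops, skip, answer, forVertices, clear, rep, copy, scan, tokenStep, lengthStep,
      this] at hx
    simp only [Formula.bound, List.mem_cons]
    exact hx.imp id (ih x)

theorem wf_eval (φ : Formula X) (h : φ.wf = true) : (eval φ).WF := by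
  induction φ with
  | eq x y => simp [eval, WF, loops, copy, rep, compare, skip, answer, clear]
  | adj x y => simp [eval, WF, loops, copy, rep, scan, skip, lookupStep]
  | neg φ ih => exact ⟨ih h, trivial⟩
  | and φ ψ ih ih' =>
    simp only [Formula.wf, Bool.and_eq_true] at h
    exact ⟨ih h.1, ih' h.2, trivial⟩
  | all y φ ih =>
    simp only [Formula.wf, Bool.and_eq_true, decide_eq_true_eq] at h
    have := mt (loops_eval φ y) h.1
    simp [eval, WF, loops, skip, answer, forVertices, clear, rep, this, ih h.2]
  | count o y φ ih =>
    simp only [Formula.wf, Bool.and_eq_true, decide_eq_true_eq] at h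
    have := mt (loops_eval φ y) h.1
    have ht : (test y o).WF := by
      cases o <;> simp [test, compare, WF, loops, rep, skip, answer, clear]
    simp [eval, WF, loops, skip, answer, forVertices, clear, rep, copy, scan, tokenStep,
      lengthStep, this, ih h.2, ht]

/-! #### The effect of the programs -/

variable {w : List Γ'}

theorem run_skip (s : Flags X × (Ctr X → ℕ)) : (skip : FCmd X).run w s = s := rfl

theorem run_rep (p : FCmd X) (s : Flags X × (Ctr X → ℕ)) :
    (rep p).run w s = (p.run w)^[w.length] s := by
  simp only [rep, run]
  exact List.foldl_const ..

theorem run_clear (c : Ctr X) (s : Flags X × (Ctr X → ℕ)) (h : s.2 c ≤ w.length) :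
    (clear c).run w s = (s.1, Function.update s.2 c 0) := by
  have key : ∀ k, ((Cmd.dec c : FCmd X).run w)^[k] s =
      (s.1, Function.update s.2 c (s.2 c - k)) := by
    intro k
    induction k with
    | zero => simp
    | succ k ih =>
      rw [Function.iterate_succ_apply', ih]
      simp [run, Nat.sub_sub]
  rw [clear, run_rep, key, Nat.sub_eq_zero_of_le h]

end FCmd

namespace FCmd

open Cmd

variable {X : Type} [DecidableEq X] {w : List Γ'}

/-- The first loop moves `c` both to `d` and to `tmp`, and the second one moves `tmp` back to `c`.
Rounds in excess of the value of the counter have no effect. -/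
theorem run_copy (c d : Ctr X) (hcd : c ≠ d) (hc : c ≠ .tmp) (hd : d ≠ .tmp)
    (s : Flags X × (Ctr X → ℕ)) (h : s.2 c ≤ w.length) (ht : s.2 .tmp = 0) :
    (copy c d).run w s = (s.1, Function.update s.2 d (s.2 d + s.2 c)) := by
  have key : ∀ k, ((Cmd.ifz c skip (.seq (.dec c) (.seq (.inc d) (.inc .tmp))) :
      FCmd X).run w)^[k] s = (s.1, Function.update (Function.update (Function.update s.2 c
        (s.2 c - k)) d (s.2 d + min k (s.2 c))) .tmp (min k (s.2 c))) := by
    intro k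
    induction k with
    | zero =>
      refine Prod.ext rfl (funext fun y => ?_)
      simp only [Function.update_apply]
      split_ifs <;> simp_all
    | succ k ih =>
      rw [Function.iterate_succ_apply', ih]
      by_cases hk : s.2 c ≤ k
      · simp [run, run_skip, hcd, hc, hk, Nat.sub_eq_zero_of_le, Nat.le_succ_of_le hk]
      · have h₁ : s.2 c - k ≠ 0 := by omega
        simp only [run, run_skip, Function.update_apply, hcd, hc, hd, hcd.symm, hc.symm, hd.symm,
          h₁, if_true, if_false]
        refine Prod.ext rfl (funext fun y => ?_)
        simp only [Function.update_apply]
        split_ifs <;> omega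
  have key' : ∀ (s : Flags X × (Ctr X → ℕ)) (k), ((Cmd.ifz .tmp skip (.seq (.dec .tmp) (.inc c)) :
      FCmd X).run w)^[k] s = (s.1, Function.update (Function.update s.2 .tmp
        (s.2 .tmp - k)) c (s.2 c + min k (s.2 .tmp))) := by
    intro s k
    induction k with
    | zero =>
      refine Prod.ext rfl (funext fun y => ?_)
      simp only [Function.update_apply]
      split_ifs <;> simp_all
    | succ k ih =>
      rw [Function.iterate_succ_apply', ih]
      by_cases hk : s.2 .tmp ≤ k
      · simp [run, run_skip, hc.symm, hk, Nat.sub_eq_zero_of_le, Nat.le_succ_of_le hk]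
      · have h₁ : s.2 .tmp - k ≠ 0 := by omega
        simp only [run, run_skip, Function.update_apply, hc, hc.symm,
          h₁, if_true, if_false]
        refine Prod.ext rfl (funext fun y => ?_)
        simp only [Function.update_apply]
        split_ifs <;> omega
  simp only [copy, run]
  rw [run_rep, run_rep, key, key']
  refine Prod.ext rfl (funext fun y => ?_)
  simp only [Function.update_apply, hcd, hc, hc.symm, hd.symm, if_true, if_false]
  split_ifs <;> simp_all

theorem run_clear₂ (c d : Ctr X) (hcd : c ≠ d) (s : Flags X × (Ctr X → ℕ)) (hc : s.2 c ≤ w.length)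
    (hd : s.2 d ≤ w.length) : (Cmd.seq (clear c) (clear d)).run w s =
      (s.1, Function.update (Function.update s.2 c 0) d 0) := by
  -- The equations `run.eq_4` and `run.eq_5` unfold `seq` and `ite`.
  rw [Cmd.run.eq_4, run_clear _ _ hc, run_clear _ _ (by simpa [hcd.symm] using hd)]

/-- Both counters are lowered simultaneously until one of them is zero; they were equal exactly if
both end at zero. -/
theorem run_compare (c d : Ctr X) (hcd : c ≠ d) (s : Flags X × (Ctr X → ℕ))
    (hc : s.2 c ≤ w.length) (hd : s.2 d ≤ w.length) :
    (compare c d).run w s = ({ s.1 with res := decide (s.2 c = s.2 d) },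
      Function.update (Function.update s.2 c 0) d 0) := by
  have key : ∀ k, ((Cmd.ifz c skip (.ifz d skip (.seq (.dec c) (.dec d))) :
      FCmd X).run w)^[k] s = (s.1, Function.update (Function.update s.2 c
        (s.2 c - min k (s.2 d))) d (s.2 d - min k (s.2 c))) := by
    intro k
    induction k with
    | zero => simp
    | succ k ih =>
      rw [Function.iterate_succ_apply', ih]
      by_cases h₁ : s.2 c - min k (s.2 d) = 0
      · simp only [run, run_skip, Function.update_apply, hcd, h₁, if_true, if_false]
        refine Prod.ext rfl (funext fun y => ?_)
        simp only [Function.update_apply]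
        split_ifs <;> omega
      · by_cases h₂ : s.2 d - min k (s.2 c) = 0
        · simp only [run, run_skip, Function.update_apply, hcd, h₁, h₂, if_true, if_false]
          refine Prod.ext rfl (funext fun y => ?_)
          simp only [Function.update_apply]
          split_ifs <;> omega
        · simp only [run, run_skip, Function.update_apply, hcd, hcd.symm, h₁, h₂, if_true, if_false]
          refine Prod.ext rfl (funext fun y => ?_)
          simp only [Function.update_apply]
          split_ifs <;> omega
  have test : ∀ t, (Cmd.ifz c (.ifz d (answer true) (answer false)) (answer false) :
      FCmd X).run w t = ({ t.1 with res := decide (t.2 c = 0 ∧ t.2 d = 0) }, t.2) := by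
    intro t
    simp only [run, answer]
    split_ifs <;> simp_all
  rw [compare, Cmd.run.eq_4, Cmd.run.eq_4, test, run_rep, key, run_clear₂ _ _ hcd]
  · refine Prod.ext ?_ (funext fun y => ?_)
    · have : (s.2 c - min w.length (s.2 d) = 0 ∧ s.2 d - min w.length (s.2 c) = 0) ↔
          s.2 c = s.2 d := by omega
      simp [hcd, this]
    · simp only [Function.update_apply]
      split_ifs <;> rfl
  · simp [hcd]; omega
  · simp; omega

theorem run_nonzero (c : Ctr X) (s : Flags X × (Ctr X → ℕ)) :
    (Cmd.ifz c (answer false) (answer true) : FCmd X).run w s =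
      ({ s.1 with res := decide (1 ≤ s.2 c) }, s.2) := by
  simp only [run, answer]
  by_cases h : s.2 c = 0
  · simp [h]
  · simp [h, Nat.one_le_iff_ne_zero]

open Classical in
theorem run_test (x : X) (o : CountTest) (s : Flags X × (Ctr X → ℕ))
    (hs : s.2 (.tokS x) ≤ w.length) (ht : s.2 (.tokT x) ≤ w.length) :
    (test x o).run w s =
      ({ s.1 with res := decide (o.Holds (s.2 (.tokS x)) (s.2 (.tokT x))) },
      Function.update (Function.update s.2 (.tokS x) 0) (.tokT x) 0) := by
  have hst : Ctr.tokS x ≠ Ctr.tokT x := by simp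
  cases o with
  | same =>
    rw [test, run_compare _ _ hst _ hs ht]
    simp only [CountTest.Holds]
    congr
  | someS =>
    rw [test, Cmd.run.eq_4, run_nonzero, run_clear₂ _ _ hst]
    · simp only [CountTest.Holds]
      congr
    · exact hs
    · exact ht
  | someT =>
    rw [test, Cmd.run.eq_4, run_nonzero, run_clear₂ _ _ hst]
    · simp only [CountTest.Holds]
      congr
    · exact hs
    · exact ht
  | three =>
    rw [test, Cmd.run.eq_4, Cmd.run.eq_4, Cmd.run.eq_4, run_nonzero, run_clear₂ _ _ hst]
    · have : 1 ≤ s.2 (.tokS x) - 1 - 1 ↔ 3 ≤ s.2 (.tokS x) := by omega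
      simp only [CountTest.Holds, run, Function.update_self, this, Function.update_idem]
      congr
    · simp [run]; omega
    · simpa [run] using ht

end FCmd

/-! ### Scans of the input: entries of the matrix and numbers of tokens -/

namespace FCmd

open Cmd

variable {X : Type} [DecidableEq X] {w : List Γ'}

/-- The effect of one step of a scan. -/
def scanStep (w : List Γ') (p : FCmd X) (s : Flags X × (Ctr X → ℕ)) (a : Γ') :
    Flags X × (Ctr X → ℕ) :=
  ({ (p.run w ({ s.1 with letter := a }, s.2)).1 with letter := .blank },
    (p.run w ({ s.1 with letter := a }, s.2)).2)

theorem run_scan (p : FCmd X) (s : Flags X × (Ctr X → ℕ)) : (scan p).run w s =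
    ({ (w.foldl (scanStep w p) s).1 with phase := 0 }, (w.foldl (scanStep w p) s).2) := rfl

/-- A list of binary words as a string, with a comma after each word. -/
def joinWords (L : List (List Bool)) : List Γ' :=
  L.flatMap fun v => v.map Γ'.bit ++ [Γ'.comma]

omit [DecidableEq X] in
theorem foldl_eq_self {α β : Type*} (f : α → β → α) (a : α) (l : List β)
    (h : ∀ b ∈ l, f a b = a) : l.foldl f a = a := by
  induction l with
  | nil => rfl
  | cons b l ih =>
    rw [List.foldl_cons, h b (by simp), ih fun b hb => h b (by simp [hb])]

section lookup

variable (r : Bool) (fl : X → Bool) (c : Ctr X → ℕ)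

theorem lookup_done (a : Γ') :
    scanStep w lookupStep (⟨r, 1, .blank, fl⟩, c) a = (⟨r, 1, .blank, fl⟩, c) := by
  simp [scanStep, lookupStep, run, run_skip]

theorem lookup_row (v : List Bool) (h : c .fst ≠ 0) :
    (v.map Γ'.bit).foldl (scanStep w lookupStep) (⟨r, 0, .blank, fl⟩, c) =
      (⟨r, 0, .blank, fl⟩, c) := by
  refine foldl_eq_self _ _ _ fun a ha => ?_
  obtain ⟨b, _, rfl⟩ := List.mem_map.1 ha
  simp [scanStep, lookupStep, run, run_skip, h]

theorem lookup_rows (L : List (List Bool)) : ∀ c : Ctr X → ℕ, L.length ≤ c .fst →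
    (joinWords L).foldl (scanStep w lookupStep) (⟨r, 0, .blank, fl⟩, c) =
      (⟨r, 0, .blank, fl⟩, Function.update c .fst (c .fst - L.length)) := by
  induction L with
  | nil => intro c _; simp [joinWords]
  | cons v L ih =>
    intro c hc
    rw [List.length_cons] at hc
    have h₀ : c .fst ≠ 0 := by omega
    have h₁ : scanStep w lookupStep (⟨r, 0, .blank, fl⟩, c) .comma =
        (⟨r, 0, .blank, fl⟩, Function.update c .fst (c .fst - 1)) := by
      simp [scanStep, lookupStep, run, h₀]
    have := ih (Function.update c .fst (c .fst - 1)) (by rw [Function.update_self]; omega)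
    simp only [joinWords, List.flatMap_cons, List.foldl_append, List.foldl_cons,
      List.foldl_nil] at this ⊢
    rw [lookup_row r fl c v h₀, h₁, this]
    simp [Nat.sub_sub, Nat.add_comm]

theorem lookup_columns (v : List Bool) : ∀ c : Ctr X → ℕ, c .fst = 0 → v.length ≤ c .snd →
    (v.map Γ'.bit).foldl (scanStep w lookupStep) (⟨r, 0, .blank, fl⟩, c) =
      (⟨r, 0, .blank, fl⟩, Function.update c .snd (c .snd - v.length)) := by
  induction v with
  | nil => intro c _ _; simp
  | cons b v ih =>
    intro c h₀ hc
    rw [List.length_cons] at hc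
    have h₂ : c .snd ≠ 0 := by omega
    have h₁ : scanStep w lookupStep (⟨r, 0, .blank, fl⟩, c) (.bit b) =
        (⟨r, 0, .blank, fl⟩, Function.update c .snd (c .snd - 1)) := by
      simp [scanStep, lookupStep, run, h₀, h₂]
    rw [List.map_cons, List.foldl_cons, h₁, ih _ (by simpa using h₀) (by simp; omega)]
    simp [Nat.sub_sub, Nat.add_comm]

/-- The commas of the rows `L` use up `fst`, then the bits `v` use up `snd`, and the next bit `b` is
recorded. In phase 1 the rest `l` is ignored. -/
theorem run_lookup (L : List (List Bool)) (v : List Bool) (b : Bool) (l : List Γ')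
    (h : w = joinWords L ++ (v.map Γ'.bit ++ Γ'.bit b :: l)) (h₁ : c .fst = L.length)
    (h₂ : c .snd = v.length) : (scan lookupStep).run w (⟨r, 0, .blank, fl⟩, c) =
      (⟨b, 0, .blank, fl⟩, Function.update (Function.update c .fst 0) .snd 0) := by
  have key : w.foldl (scanStep w lookupStep) (⟨r, 0, .blank, fl⟩, c) =
      (⟨b, 1, .blank, fl⟩, Function.update (Function.update c .fst 0) .snd 0) := by
    conv_lhs => arg 3; rw [h]
    rw [List.foldl_append, List.foldl_append, List.foldl_cons, lookup_rows r fl L c h₁.ge,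
      lookup_columns _ _ _ _ (by simp [h₁]) (by simp [h₂])]
    have h₃ : ∀ c : Ctr X → ℕ, c .fst = 0 → c .snd = 0 →
        scanStep w lookupStep (⟨r, 0, .blank, fl⟩, c) (.bit b) = (⟨b, 1, .blank, fl⟩, c) := by
      intro c h₁ h₂
      cases b <;> simp [scanStep, lookupStep, run, h₁, h₂]
    rw [h₃ _ (by simp [h₁]) (by simp [h₂]), foldl_eq_self _ _ _ fun a _ => lookup_done ..]
    simp [h₁, h₂]
  rw [run_scan, key]

end lookup

section length

variable {P : FCmd X} {p q : Fin 5} {k d : Ctr X}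

/-- During phase `p`, the scan by `P` measures the length of the word with the number `d`, and then
it goes on to phase `q`. -/
structure Measures (w : List Γ') (P : FCmd X) (p q : Fin 5) (d k : Ctr X) : Prop where
  ne : d ≠ k
  step : ∀ s, s.1.phase = p → s.1.letter ≠ .ket → P.run w s = (lengthStep d k q).run w s
  idle : ∀ s, s.1.phase = q → s.1.letter ≠ .ket → P.run w s = s

theorem ket_notMem_joinWords (L : List (List Bool)) : Γ'.ket ∉ joinWords L := by
  simp [joinWords]

variable (hP : Measures w P p q d k) (r : Bool) (fl : X → Bool)

include hP

theorem Measures.foldl_idle (c : Ctr X → ℕ) (l : List Γ') (hl : Γ'.ket ∉ l) :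
    l.foldl (scanStep w P) (⟨r, q, .blank, fl⟩, c) = (⟨r, q, .blank, fl⟩, c) := by
  refine foldl_eq_self _ _ _ fun a ha => ?_
  have : a ≠ .ket := fun e => hl (e ▸ ha)
  simp only [scanStep]
  rw [hP.idle _ rfl this]

theorem Measures.step_bit (c : Ctr X → ℕ) (b : Bool) (h : c d ≠ 0) :
    scanStep w P (⟨r, p, .blank, fl⟩, c) (.bit b) = (⟨r, p, .blank, fl⟩, c) := by
  simp only [scanStep]
  rw [hP.step _ rfl (by simp)]
  simp [lengthStep, run, run_skip, h]

theorem Measures.step_comma (c : Ctr X → ℕ) (h : c d ≠ 0) :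
    scanStep w P (⟨r, p, .blank, fl⟩, c) .comma =
      (⟨r, p, .blank, fl⟩, Function.update c d (c d - 1)) := by
  simp only [scanStep]
  rw [hP.step _ rfl (by simp)]
  simp [lengthStep, run, h]

theorem Measures.foldl_skip (L : List (List Bool)) : ∀ c : Ctr X → ℕ, L.length ≤ c d →
    (joinWords L).foldl (scanStep w P) (⟨r, p, .blank, fl⟩, c) =
      (⟨r, p, .blank, fl⟩, Function.update c d (c d - L.length)) := by
  induction L with
  | nil => intro c _; simp [joinWords]
  | cons v L ih =>
    intro c hc
    rw [List.length_cons] at hc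
    have h₀ : c d ≠ 0 := by omega
    have := ih (Function.update c d (c d - 1)) (by rw [Function.update_self]; omega)
    simp only [joinWords, List.flatMap_cons, List.foldl_append, List.foldl_cons,
      List.foldl_nil] at this ⊢
    have h₁ : (v.map Γ'.bit).foldl (scanStep w P) (⟨r, p, .blank, fl⟩, c) =
        (⟨r, p, .blank, fl⟩, c) := by
      refine foldl_eq_self _ _ _ fun a ha => ?_
      obtain ⟨b, _, rfl⟩ := List.mem_map.1 ha
      exact hP.step_bit r fl c b h₀
    rw [h₁, hP.step_comma r fl c h₀, this]
    simp [Nat.sub_sub, Nat.add_comm]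

theorem Measures.foldl_count (v : List Bool) : ∀ c : Ctr X → ℕ, c d = 0 →
    (v.map Γ'.bit).foldl (scanStep w P) (⟨r, p, .blank, fl⟩, c) =
      (⟨r, p, .blank, fl⟩, Function.update c k (c k + v.length)) := by
  induction v with
  | nil => intro c _; simp
  | cons b v ih =>
    intro c h₀
    have h₁ : scanStep w P (⟨r, p, .blank, fl⟩, c) (.bit b) =
        (⟨r, p, .blank, fl⟩, Function.update c k (c k + 1)) := by
      simp only [scanStep]
      rw [hP.step _ rfl (by simp)]
      simp [lengthStep, run, h₀]
    rw [List.map_cons, List.foldl_cons, h₁, ih _ (by simpa [hP.ne] using h₀)]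
    simp [Nat.add_comm, Nat.add_left_comm]

theorem Measures.foldl_words (c : Ctr X → ℕ) (L L' : List (List Bool)) (v : List Bool)
    (h : c d = L.length) : (joinWords (L ++ v :: L')).foldl (scanStep w P)
      (⟨r, p, .blank, fl⟩, c) =
      (⟨r, q, .blank, fl⟩, Function.update (Function.update c d 0) k (c k + v.length)) := by
  have e : joinWords (L ++ v :: L') =
      joinWords L ++ (v.map Γ'.bit ++ Γ'.comma :: joinWords L') := by simp [joinWords]
  rw [e, List.foldl_append, List.foldl_append, List.foldl_cons, hP.foldl_skip r fl L c h.ge,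
    hP.foldl_count r fl v _ (by simp [h])]
  have h₁ : ∀ c : Ctr X → ℕ, c d = 0 → scanStep w P (⟨r, p, .blank, fl⟩, c) .comma =
      (⟨r, q, .blank, fl⟩, c) := by
    intro c hc
    simp only [scanStep]
    rw [hP.step _ rfl (by simp)]
    simp [lengthStep, run, hc]
  rw [h₁ _ (by simp [h, hP.ne]), hP.foldl_idle r fl _ _ (ket_notMem_joinWords _)]
  simp [h, hP.ne.symm]

end length

theorem measures_source (w : List Γ') (x : X) :
    Measures w (tokenStep x) 1 2 .fst (.tokS x) where
  ne := by simp
  step s hs hl := by simp [tokenStep, run, hs, hl]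
  idle s hs hl := by simp [tokenStep, run, hs, hl, run_skip]

theorem measures_target (w : List Γ') (x : X) :
    Measures w (tokenStep x) 3 4 .snd (.tokT x) where
  ne := by simp
  step s hs hl := by simp [tokenStep, run, hs, hl]
  idle s hs hl := by simp [tokenStep, run, hs, hl, run_skip]

/-- Phase 0 passes over the matrix, phases 1 and 3 measure a word of the initial and of the target
configuration, and phases 2 and 4 ignore the rest of each list. Each measurement uses up its index,
which is why the vertex is supplied both in `fst` and in `snd`. -/
theorem run_tokens (x : X) (r : Bool) (fl : X → Bool) (c : Ctr X → ℕ)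
    (K L L' M M' : List (List Bool)) (u v : List Bool)
    (h : w = encodeWords K ++ encodeWords (L ++ u :: L') ++ encodeWords (M ++ v :: M'))
    (h₁ : c .fst = L.length) (h₂ : c .snd = M.length) :
    (scan (tokenStep x)).run w (⟨r, 0, .blank, fl⟩, c) =
      (⟨r, 0, .blank, fl⟩, Function.update (Function.update (Function.update (Function.update c
        .fst 0) .snd 0) (.tokS x) (c (.tokS x) + u.length)) (.tokT x)
        (c (.tokT x) + v.length)) := by
  have hw : w = joinWords K ++ Γ'.ket :: (joinWords (L ++ u :: L') ++ Γ'.ket ::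
      (joinWords (M ++ v :: M') ++ [Γ'.ket])) := by
    rw [h]
    simp only [encodeWords, joinWords, List.append_assoc, List.nil_append,
      List.cons_append]
  have ket : ∀ (p : Fin 5) (c : Ctr X → ℕ),
      scanStep w (tokenStep x) (⟨r, p, .blank, fl⟩, c) .ket =
        (⟨r, if p = 0 then 1 else if p = 2 then 3 else p, .blank, fl⟩, c) := by
    intro p c
    simp [scanStep, tokenStep, run]
  have start : (joinWords K).foldl (scanStep w (tokenStep x)) (⟨r, 0, .blank, fl⟩, c) =
      (⟨r, 0, .blank, fl⟩, c) := by
    refine foldl_eq_self _ _ _ fun a ha => ?_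
    have : a ≠ .ket := fun e => ket_notMem_joinWords K (e ▸ ha)
    simp [scanStep, tokenStep, run, this, run_skip]
  have key : w.foldl (scanStep w (tokenStep x)) (⟨r, 0, .blank, fl⟩, c) =
      (⟨r, 4, .blank, fl⟩, Function.update (Function.update (Function.update (Function.update c
        .fst 0) (.tokS x) (c (.tokS x) + u.length)) .snd 0) (.tokT x)
        (c (.tokT x) + v.length)) := by
    conv_lhs => arg 3; rw [hw]
    rw [List.foldl_append, start, List.foldl_cons, ket, if_pos rfl, List.foldl_append,
      (measures_source w x).foldl_words r fl c L L' u h₁, List.foldl_cons, ket,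
      if_neg (by decide), if_pos rfl, List.foldl_append,
      (measures_target w x).foldl_words r fl _ M M' v (by simp [h₂]), List.foldl_cons, ket,
      if_neg (by decide), if_neg (by decide), List.foldl_nil]
    simp
  rw [run_scan, key]
  refine Prod.ext rfl (funext fun y => ?_)
  simp only [Function.update_apply]
  split_ifs <;> simp_all

end FCmd

namespace FCmd

open Cmd

/-! #### The encoding of an instance -/

theorem encodeWords_eq (L : List (List Bool)) : encodeWords L = joinWords L ++ [Γ'.ket] := rfl

theorem exists_eq_append_cons {α : Type*} {n : ℕ} (f : Fin n → α) (i : Fin n) :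
    ∃ L L' : List α, (List.finRange n).map f = L ++ f i :: L' ∧ L.length = i := by
  refine ⟨((List.finRange n).map f).take i, ((List.finRange n).map f).drop (i + 1), ?_, ?_⟩
  · have h : (i : ℕ) < ((List.finRange n).map f).length := by simp
    conv_lhs => rw [← List.take_append_drop i ((List.finRange n).map f),
      List.drop_eq_getElem_cons h]
    simp
  · simp [i.2.le]

open Classical in
theorem exists_encode_eq_adj (I : DSRInstance) (x y : Fin I.n) :
    ∃ (L : List (List Bool)) (v : List Bool) (l : List Γ'),
      I.encode = joinWords L ++ (v.map Γ'.bit ++ Γ'.bit (decide (I.G.Adj x y)) :: l) ∧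
      L.length = x ∧ v.length = y := by
  obtain ⟨L, L', h, hL⟩ := exists_eq_append_cons
    (fun i => (List.finRange I.n).map fun j => decide (I.G.Adj i j)) x
  obtain ⟨v, v', h', hv⟩ := exists_eq_append_cons (fun j => decide (I.G.Adj x j)) y
  rw [h'] at h
  refine ⟨L, v, v'.map Γ'.bit ++ Γ'.comma :: (joinWords L' ++ Γ'.ket ::
    (encodeWords (tokenWords I.Ds) ++ encodeWords (tokenWords I.Dt))), ?_, hL, hv⟩
  rw [DSRInstance.encode, adjacencyRows, h, encodeWords_eq]
  simp only [joinWords, List.flatMap_append, List.flatMap_cons, List.map_append, List.map_cons,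
    List.append_assoc, List.cons_append, List.nil_append]

theorem exists_tokenWords_eq {n : ℕ} (D : Multiset (Fin n)) (x : Fin n) :
    ∃ (L L' : List (List Bool)) (u : List Bool), tokenWords D = L ++ u :: L' ∧
      L.length = x ∧ u.length = D.count x := by
  obtain ⟨L, L', h, hL⟩ := exists_eq_append_cons (fun i => List.replicate (D.count i) true) x
  exact ⟨L, L', _, h, hL, by simp⟩

/-- The first row of the matrix has one bit per vertex and so drives the loops over the vertices; a
graph without vertices has no such row. -/
theorem exists_encode_eq_row (I : DSRInstance) (h : 0 < I.n) :
    ∃ (v : List Bool) (l : List Γ'), I.encode = v.map Γ'.bit ++ Γ'.comma :: l ∧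
      v.length = I.n := by
  classical
  obtain ⟨L, L', h', hL⟩ := exists_eq_append_cons
    (fun i => (List.finRange I.n).map fun j => decide (I.G.Adj i j)) ⟨0, h⟩
  rw [List.length_eq_zero_iff] at hL
  subst hL
  refine ⟨(List.finRange I.n).map fun j => decide (I.G.Adj ⟨0, h⟩ j),
    joinWords L' ++ Γ'.ket :: (encodeWords (tokenWords I.Ds) ++ encodeWords (tokenWords I.Dt)),
    ?_, by simp⟩
  rw [DSRInstance.encode, adjacencyRows, h', encodeWords_eq]
  simp only [joinWords, List.flatMap_cons, List.nil_append,
    List.append_assoc, List.cons_append]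

/-- This is where the unary encoding matters: token counts fit into counters that are handled by
loops over the input. -/
theorem card_le_length_encodeWords {n : ℕ} (D : Multiset (Fin n)) :
    D.card ≤ (encodeWords (tokenWords D)).length := by
  have h : D.card = ((List.finRange n).map fun i => D.count i).sum := by
    rw [← Multiset.sum_count_eq_card (s := Finset.univ) (m := D) (fun _ _ => Finset.mem_univ _)]
    exact Fin.sum_univ_def _
  rw [h, encodeWords, tokenWords, List.length_append, List.length_flatMap, List.map_map]
  refine le_trans (List.sum_le_sum fun i _ => ?_) (Nat.le_add_right _ _)
  simp

theorem card_source_le (I : DSRInstance) : I.Ds.card ≤ I.encode.length := by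
  have := card_le_length_encodeWords I.Ds
  simp only [DSRInstance.encode, List.length_append]
  omega

theorem card_target_le (I : DSRInstance) : I.Dt.card ≤ I.encode.length := by
  have := card_le_length_encodeWords I.Dt
  simp only [DSRInstance.encode, List.length_append]
  omega

theorem n_le (I : DSRInstance) : I.n ≤ I.encode.length := by
  rcases Nat.eq_zero_or_pos I.n with h | h
  · omega
  · obtain ⟨v, l, h, hv⟩ := exists_encode_eq_row I h
    rw [h, ← hv]
    simp

variable {X : Type} [DecidableEq X]

/-! #### Loops over the vertices -/

/-- The family `T` is a loop invariant: `T z` is the state after the vertices below `z` have been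
treated. The first comma switches the loop off, and the remaining letters have no effect. -/
theorem run_forVertices (I : DSRInstance) (h : 0 < I.n) (x : X) (p : FCmd X)
    (T : ℕ → Flags X × (Ctr X → ℕ)) (hx : ∀ z, (T z).1.live x = true) (hn : (T I.n).2 (.var x) = I.n)
    (hT : ∀ z < I.n, (Cmd.inc (.var x) : FCmd X).run I.encode (p.run I.encode (T z)) = T (z + 1)) :
    (forVertices x p).run I.encode (T 0) = ((T I.n).1, Function.update (T I.n).2 (.var x) 0) := by
  obtain ⟨v, l, hw, hv⟩ := exists_encode_eq_row I h
  have hn' := n_le I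
  set w := I.encode with hw'
  let f : Flags X × (Ctr X → ℕ) → Γ' → Flags X × (Ctr X → ℕ) := fun s a =>
    (Cmd.ite (fun s => s.live x) (.seq p (.inc (.var x))) skip : FCmd X).run w
      ({ s.1 with live := Function.update s.1.live x (s.1.live x && isBit a) }, s.2)
  have first : ∀ (v : List Bool) (z : ℕ), z + v.length ≤ I.n →
      (v.map Γ'.bit).foldl f (T z) = T (z + v.length) := by
    intro v
    induction v with
    | nil => intro z _; rfl
    | cons b v ih =>
      intro z hz
      rw [List.length_cons] at hz
      have h₁ : f (T z) (.bit b) = T (z + 1) := by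
        have : ((T z).1.live x && isBit (.bit b)) = (T z).1.live x := by simp [isBit]
        simp only [f]
        rw [this, Function.update_eq_self, run.eq_5, if_pos (hx z)]
        exact hT z (by omega)
      rw [List.map_cons, List.foldl_cons, h₁, ih (z + 1) (by omega), List.length_cons]
      congr 1; omega
  let s₁ : Flags X × (Ctr X → ℕ) :=
    ({ (T I.n).1 with live := Function.update (T I.n).1.live x false }, (T I.n).2)
  have stay : ∀ a, f s₁ a = s₁ := by
    intro a
    simp [f, run, run_skip, s₁]
  have comma : f (T I.n) .comma = s₁ := by
    simp [f, run, run_skip, s₁, isBit]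
  have all : w.foldl f (T 0) = s₁ := by
    rw [hw, List.foldl_append, List.foldl_cons, first v 0 (by omega), Nat.zero_add, hv, comma,
      foldl_eq_self _ _ _ fun a _ => stay a]
  have e : ({ s₁.1 with live := Function.update s₁.1.live x true } : Flags X) = (T I.n).1 := by
    simp only [s₁, Function.update_idem, ← hx I.n, Function.update_eq_self]
  have run₁ : (forVertices x p).run w (T 0) =
      (clear (.var x)).run w
        ({ (w.foldl f (T 0)).1 with live := Function.update (w.foldl f (T 0)).1.live x true },
          (w.foldl f (T 0)).2) := rfl
  rw [run₁, all, run_clear _ _ (by simpa [s₁, hn] using hn')]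
  exact Prod.ext e rfl

end FCmd

/-! ### Correctness of the evaluation of formulas -/

namespace FCmd

open Cmd

variable {X : Type} [DecidableEq X]

theorem countP_lt_succ {n : ℕ} (D : Multiset (Fin n)) (p : Fin n → Prop) [DecidablePred p]
    (z : ℕ) (hz : z < n) : D.countP (fun v => v.val < z + 1 ∧ p v) =
      D.countP (fun v => v.val < z ∧ p v) + if p ⟨z, hz⟩ then D.count ⟨z, hz⟩ else 0 := by
  induction D using Multiset.induction_on with
  | empty => simp
  | cons a D ih =>
    simp only [Multiset.countP_cons, Multiset.count_cons, ih]
    have : (⟨z, hz⟩ : Fin n) = a ↔ a.val = z := by rw [Fin.ext_iff]; exact eq_comm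
    by_cases h : a.val = z
    · have e := this.2 h
      subst e
      by_cases hp : p ⟨z, hz⟩ <;> simp [hp]
      omega
    · have e : a.val < z + 1 ↔ a.val < z := by omega
      simp only [this, h, e, if_false, add_zero]
      split_ifs <;> omega

theorem run_copies {w : List Γ'} (x y : X) (p : FCmd X) (s : Flags X × (Ctr X → ℕ))
    (hx : s.2 (.var x) ≤ w.length) (hy : s.2 (.var y) ≤ w.length) (ht : s.2 .tmp = 0) :
    (Cmd.seq (copy (.var x) .fst) (.seq (copy (.var y) .snd) p)).run w s =
      p.run w (s.1, Function.update (Function.update s.2 .fst (s.2 .fst + s.2 (.var x))) .snd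
        (s.2 .snd + s.2 (.var y))) := by
  rw [run.eq_4, run.eq_4, run_copy _ _ (by simp) (by simp) (by simp) s hx ht,
    run_copy _ _ (by simp) (by simp) (by simp) (s.1, _) (by simpa) (by simpa)]
  simp

open Classical in
/-- The program that evaluates `φ` is correct. -/
def Correct (I : DSRInstance) (φ : Formula X) : Prop :=
  ∀ (e : X → Fin I.n) (r : Bool) (fl : X → Bool) (c : Ctr X → ℕ),
    (∀ x ∈ φ.bound, (e x : ℕ) = 0 ∧ fl x = true ∧ c (.tokS x) = 0 ∧ c (.tokT x) = 0) →
    (∀ x, c (.var x) = e x) → c .fst = 0 → c .snd = 0 → c .tmp = 0 →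
    (eval φ).run I.encode (⟨r, 0, .blank, fl⟩, c) =
      (⟨decide (φ.Eval I e), 0, .blank, fl⟩, c)

variable {I : DSRInstance}

open Classical in
theorem correct_all (hI : 0 < I.n) (x : X) (φ : Formula X) (hφ : x ∉ φ.bound)
    (ih : Correct I φ) : Correct I (.all x φ) := by
  intro e r fl c hb hc h₁ h₂ h₃
  simp only [Formula.bound, List.mem_cons, forall_eq_or_imp] at hb
  -- The result after `z` rounds is the conjunction over the vertices below `z`; once it is false,
  -- `φ` is no longer evaluated.
  let T : ℕ → Flags X × (Ctr X → ℕ) := fun z =>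
    (⟨decide (∀ v : Fin I.n, v.val < z → φ.Eval I (Function.update e x v)), 0, .blank, fl⟩,
      Function.update c (.var x) z)
  have key := run_forVertices I hI x (.ite (fun s => s.res) (eval φ) skip) T
    (fun _ => hb.1.2.1) (by simp [T]) (by
      intro z hz
      have hT : (Cmd.ite (fun s => s.res) (eval φ) skip : FCmd X).run I.encode (T z) =
          (⟨decide (∀ v : Fin I.n, v.val < z + 1 → φ.Eval I (Function.update e x v)), 0,
            .blank, fl⟩, Function.update c (.var x) z) := by
        have hs : (∀ v : Fin I.n, v.val < z + 1 → φ.Eval I (Function.update e x v)) ↔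
            (∀ v : Fin I.n, v.val < z → φ.Eval I (Function.update e x v)) ∧
            φ.Eval I (Function.update e x ⟨z, hz⟩) := by
          constructor
          · exact fun h => ⟨fun v hv => h v (by omega), h ⟨z, hz⟩ (by simp)⟩
          · intro h v hv
            rcases Nat.lt_succ_iff_lt_or_eq.1 hv with hv | hv
            · exact h.1 v hv
            · have : v = ⟨z, hz⟩ := Fin.ext hv
              exact this ▸ h.2
        by_cases h : ∀ v : Fin I.n, v.val < z → φ.Eval I (Function.update e x v)
        · simp only [run.eq_5, T, decide_eq_true h, if_true]
          rw [ih (Function.update e x ⟨z, hz⟩)]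
          · congr 2
            rw [decide_eq_decide, hs]
            exact ⟨fun h' => ⟨h, h'⟩, fun h' => h'.2⟩
          · intro y hy
            have : y ≠ x := fun e => hφ (e ▸ hy)
            simpa [this] using hb.2 y hy
          · intro y
            by_cases hy : y = x
            · subst hy; simp
            · simp [hy, hc]
          · simpa using h₁
          · simpa using h₂
          · simpa using h₃
        · have h' := fun h' => h (hs.1 h').1
          simp only [run.eq_5, T, decide_eq_false h, decide_eq_false h', run_skip]
          simp
      rw [hT]
      simp [run, T])
  have h₀ : (answer true : FCmd X).run I.encode (⟨r, 0, .blank, fl⟩, c) = T 0 := by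
    -- The counter of a bound variable is zero outside its loop, so the loop starts at vertex 0
    -- without initialization.
    have : Function.update c (.var x) 0 = c := by
      rw [Function.update_eq_iff]
      exact ⟨by rw [hc, hb.1.1], fun _ _ => rfl⟩
    simp [answer, run, T, this]
  rw [eval, run.eq_4, h₀, key]
  refine Prod.ext (by simp only [T, Formula.Eval, Fin.is_lt, forall_true_left]; congr)
    (funext fun y => ?_)
  simp only [T, Function.update_apply]
  split_ifs with hy
  · rw [hy, hc, hb.1.1]
  · rfl

theorem run_addTokens (x : X) (z : Fin I.n) (b : Bool) (fl : X → Bool) (c : Ctr X → ℕ)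
    (hx : c (.var x) = z) (h₁ : c .fst = 0) (h₂ : c .snd = 0) (h₃ : c .tmp = 0) :
    (Cmd.seq (.ite (fun s => s.res) (.seq (copy (.var x) .fst) (.seq (copy (.var x) .snd)
      (scan (tokenStep x)))) skip) (answer false) : FCmd X).run I.encode
      (⟨b, 0, .blank, fl⟩, c) = (⟨false, 0, .blank, fl⟩, Function.update (Function.update c
        (.tokS x) (c (.tokS x) + if b = true then I.Ds.count z else 0))
        (.tokT x) (c (.tokT x) + if b = true then I.Dt.count z else 0)) := by
  cases b with
  | false => simp [run, run_skip, answer]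
  | true =>
    have hz' : c (.var x) ≤ I.encode.length := by have := n_le I; omega
    obtain ⟨L, L', u, hu, hL, hu'⟩ := exists_tokenWords_eq I.Ds z
    obtain ⟨M, M', v, hv, hM, hv'⟩ := exists_tokenWords_eq I.Dt z
    have hw : I.encode = encodeWords (adjacencyRows I.G) ++ encodeWords (L ++ u :: L') ++
        encodeWords (M ++ v :: M') := by rw [← hu, ← hv]; rfl
    rw [run.eq_4, run.eq_5, if_pos rfl, run_copies x x _ _ hz' hz' h₃,
      run_tokens x _ _ _ _ L L' M M' u v hw (by simp [hL, h₁, hx]) (by simp [hM, h₂, hx])]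
    simp only [answer, run, hu', hv', if_true]
    refine Prod.ext rfl (funext fun y => ?_)
    simp only [Function.update_apply]
    split_ifs <;> simp_all

open Classical in
theorem correct_count (hI : 0 < I.n) (o : CountTest) (x : X) (φ : Formula X) (hφ : x ∉ φ.bound)
    (ih : Correct I φ) : Correct I (.count o x φ) := by
  intro e r fl c hb hc h₁ h₂ h₃
  simp only [Formula.bound, List.mem_cons, forall_eq_or_imp] at hb
  let P : Fin I.n → Prop := fun v => φ.Eval I (Function.update e x v)
  let S : Multiset (Fin I.n) → ℕ → ℕ := fun D z => D.countP fun v => v.val < z ∧ P v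
  let C : ℕ → ℕ → ℕ → Ctr X → ℕ := fun z s t =>
    Function.update (Function.update (Function.update c (.var x) z) (.tokS x) s) (.tokT x) t
  -- After `z` rounds the counters hold the numbers of tokens on the vertices below `z` that satisfy
  -- `φ`; the result is reset to false in each round.
  let T : ℕ → Flags X × (Ctr X → ℕ) := fun z =>
    (⟨false, 0, .blank, fl⟩, C z (S I.Ds z) (S I.Dt z))
  have key := run_forVertices I hI x (.seq (eval φ) (.seq (.ite (fun s => s.res)
      (.seq (copy (.var x) .fst) (.seq (copy (.var x) .snd) (scan (tokenStep x)))) skip)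
      (answer false))) T (fun _ => hb.1.2.1) (by simp [T, C]) (by
      intro z hz
      have h₄ : (eval φ).run I.encode (T z) =
          (⟨decide (P ⟨z, hz⟩), 0, .blank, fl⟩, C z (S I.Ds z) (S I.Dt z)) := by
        refine ih (Function.update e x ⟨z, hz⟩) _ _ _ ?_ ?_ ?_ ?_ ?_
        · intro y hy
          have : y ≠ x := fun e => hφ (e ▸ hy)
          simpa [this, C] using hb.2 y hy
        · intro y
          by_cases hy : y = x
          · subst hy; simp [C]
          · simp [hy, hc, C]
        · simpa [C] using h₁
        · simpa [C] using h₂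
        · simpa [C] using h₃
      rw [run.eq_4, h₄, run_addTokens x ⟨z, hz⟩ _ _ _ (by simp [C]) (by simpa [C] using h₁)
        (by simpa [C] using h₂) (by simpa [C] using h₃)]
      simp only [run, T, S, countP_lt_succ _ P z hz, decide_eq_true_eq]
      refine Prod.ext rfl (funext fun y => ?_)
      simp only [C, Function.update_apply]
      split_ifs <;> simp_all)
  have h₀ : (answer false : FCmd X).run I.encode (⟨r, 0, .blank, fl⟩, c) = T 0 := by
    refine Prod.ext rfl (funext fun y => ?_)
    simp only [answer, run, T, C, S, Function.update_apply]
    split_ifs with hy hy hy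
    · simp [hy, hb.1]
    · simp [hy, hb.1]
    · simp [hy, hb.1, hc]
    · rfl
  have hS : ∀ D : Multiset (Fin I.n), S D I.n = D.countP P := by
    intro D
    simp [S]
  rw [eval, run.eq_4, h₀, run.eq_4, key, run_test]
  · refine Prod.ext ?_ (funext fun y => ?_)
    · simp only [T, C, hS, Formula.Eval]
      congr 1
      simp [P]
      congr
    · simp only [T, C, Function.update_apply]
      split_ifs with hy hy hy
      · simp [hy, hb.1]
      · simp [hy, hb.1]
      · simp [hy, hb.1, hc]
      · rfl
  · simpa [T, C, hS] using (Multiset.countP_le_card P I.Ds).trans (card_source_le I)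
  · simpa [T, C, hS] using (Multiset.countP_le_card P I.Dt).trans (card_target_le I)


/-- The programs that evaluate formulas are correct. -/
theorem correct_of_wf (hI : 0 < I.n) (φ : Formula X) (hφ : φ.wf = true) : Correct I φ := by
  have hn := n_le I
  induction φ with
  | eq x y =>
    intro e r fl c _ hc h₁ h₂ h₃
    have hx : c (.var x) ≤ I.encode.length := by rw [hc]; omega
    have hy : c (.var y) ≤ I.encode.length := by rw [hc]; omega
    rw [eval, run_copies x y _ _ hx hy h₃,
      run_compare _ _ (by simp) _ (by simpa [h₁]) (by simpa [h₂])]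
    have : c (.var x) = c (.var y) ↔ (Formula.eq x y).Eval I e := by
      rw [hc, hc]
      exact Fin.ext_iff.symm
    refine Prod.ext (by simp [h₁, h₂, this]) (funext fun z => ?_)
    simp only [Function.update_apply]
    split_ifs <;> simp_all
  | adj x y =>
    intro e r fl c _ hc h₁ h₂ h₃
    have hx : c (.var x) ≤ I.encode.length := by rw [hc]; omega
    have hy : c (.var y) ≤ I.encode.length := by rw [hc]; omega
    obtain ⟨L, v, l, hw, hL, hv⟩ := exists_encode_eq_adj I (e x) (e y)
    rw [eval, run_copies x y _ _ hx hy h₃,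
      run_lookup _ _ _ L v _ l hw (by simp [h₁, hc, hL]) (by simp [h₂, hc, hv])]
    refine Prod.ext (by simp only [Formula.Eval]; congr) (funext fun z => ?_)
    simp only [Function.update_apply]
    split_ifs <;> simp_all
  | neg φ ih =>
    intro e r fl c hb hc h₁ h₂ h₃
    rw [eval, run.eq_4, ih hφ e r fl c hb hc h₁ h₂ h₃]
    by_cases h : φ.Eval I e <;> simp [run, Formula.Eval, h]
  | and φ ψ ih ih' =>
    intro e r fl c hb hc h₁ h₂ h₃
    simp only [Formula.wf, Bool.and_eq_true] at hφ
    simp only [Formula.bound, List.mem_append] at hb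
    rw [eval, run.eq_4, ih hφ.1 e r fl c (fun x hx => hb x (Or.inl hx)) hc h₁ h₂ h₃]
    by_cases h : φ.Eval I e
    · rw [run.eq_5, if_pos (by simp [h]),
        ih' hφ.2 e _ fl c (fun x hx => hb x (Or.inr hx)) hc h₁ h₂ h₃]
      have : (φ.and ψ).Eval I e ↔ ψ.Eval I e := by simp [Formula.Eval, h]
      exact Prod.ext (Flags.ext (decide_eq_decide.2 this.symm) rfl rfl rfl) rfl
    · simp [run.eq_5, h, run_skip, Formula.Eval]
  | all x φ ih =>
    simp only [Formula.wf, Bool.and_eq_true, decide_eq_true_eq] at hφ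
    exact correct_all hI x φ hφ.1 (ih hφ.2)
  | count o x φ ih =>
    simp only [Formula.wf, Bool.and_eq_true, decide_eq_true_eq] at hφ
    exact correct_count hI o x φ hφ.1 (ih hφ.2)

/-- A property of instances with at least one vertex that is defined by a formula is decidable
in polynomial time. -/
theorem polyTimeDecidable_of_formula [Fintype X] {α : Type} (inst : α → DSRInstance)
    (hinst : ∀ a, 0 < (inst a).n) (P : α → Prop) (φ : Formula X) (hφ : φ.wf = true)
    (h : ∀ a e, φ.Eval (inst a) e ↔ P a) : PolyTimeDecidable (fun a => (inst a).encode) P := by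
  classical
  -- All counters start at zero, which is the assignment of vertex 0 to every variable. All counters
  -- also end at zero, as the machine requires.
  have key := fun a => correct_of_wf (hinst a) φ hφ (fun _ => ⟨0, hinst a⟩) false
    (fun _ => true) (fun _ => 0) (fun _ _ => ⟨rfl, rfl, rfl, rfl⟩) (fun _ => rfl) rfl rfl rfl
  refine Cmd.polyTimeDecidable (eval φ) (wf_eval φ hφ) ⟨false, 0, .blank, fun _ => true⟩
    (fun s => s.res) (fun a => ?_) (fun a => ?_)
  · rw [key]
  · rw [key, decide_eq_true_iff]
    exact h a _

end FCmd

/-! ### A formula for reconfigurability in cographs -/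

namespace Formula

section Connectives

variable {X : Type} [DecidableEq X]

/-- Disjunction. -/
def or (φ ψ : Formula X) : Formula X :=
  neg (and (neg φ) (neg ψ))

/-- Existential quantification. -/
def ex (x : X) (φ : Formula X) : Formula X :=
  neg (all x (neg φ))

variable (I : DSRInstance) (e : X → Fin I.n) (x y : X) (φ ψ : Formula X)

theorem eval_eq : (eq x y).Eval I e ↔ e x = e y := Iff.rfl

theorem eval_adj : (adj x y).Eval I e ↔ I.G.Adj (e x) (e y) := Iff.rfl

theorem eval_neg : (neg φ).Eval I e ↔ ¬ φ.Eval I e := Iff.rfl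

theorem eval_and : (and φ ψ).Eval I e ↔ φ.Eval I e ∧ ψ.Eval I e := Iff.rfl

theorem eval_all : (all x φ).Eval I e ↔ ∀ v, φ.Eval I (Function.update e x v) := Iff.rfl

theorem eval_or : (or φ ψ).Eval I e ↔ φ.Eval I e ∨ ψ.Eval I e := by
  simp only [or, eval_neg, eval_and]
  tauto

theorem eval_ex : (ex x φ).Eval I e ↔ ∃ v, φ.Eval I (Function.update e x v) := by
  simp only [ex, eval_neg, eval_all, not_forall, not_not]

theorem eval_count {I : DSRInstance} {e : X → Fin I.n} {x : X} {φ : Formula X} (o : CountTest)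
    {p : Fin I.n → Prop} [DecidablePred p] (h : ∀ v, φ.Eval I (Function.update e x v) ↔ p v) :
    (count o x φ).Eval I e ↔ o.Holds (I.Ds.countP p) (I.Dt.countP p) := by
  obtain rfl : (fun v => φ.Eval I (Function.update e x v)) = p := funext fun v => propext (h v)
  rw [Eval]
  -- Only the decidability instances differ.
  congr!

end Connectives

/-- The vertices `x` and `y` are near. -/
def near (x y : Fin 8) : Formula (Fin 8) :=
  or (eq y x) (or (adj x y) (ex 1 (and (adj x 1) (adj 1 y))))

/-- The vertices `x` and `y` dominate the component of the vertex `0`. -/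
def dominates (x y : Fin 8) : Formula (Fin 8) :=
  all 2 (or (neg (near 0 2)) (or (or (eq 2 x) (eq 2 y)) (or (adj x 2) (adj y 2))))

/-- `xy` is a dominating edge of the component of the vertex `0`. -/
def dominatingEdge (x y : Fin 8) : Formula (Fin 8) :=
  and (adj x y) (dominates x y)

/-- The component of the vertex `0` is flexible. -/
def flexible : Formula (Fin 8) :=
  or (ex 4 (ex 5 (and (near 0 4) (and (near 0 5) (and (dominates 4 5) (neg (adj 4 5)))))))
    (ex 4 (ex 5 (ex 6 (and (near 0 4) (and (near 0 5) (and (near 0 6)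
      (and (dominatingEdge 4 5) (and (dominatingEdge 5 6) (dominatingEdge 4 6)))))))))

/-- A token on `x` can slide to `x'`, given a token on `y`. -/
def linked (x x' y : Fin 8) : Formula (Fin 8) :=
  or (eq x x') (or (adj x x') (ex 3 (and (adj x 3) (and (adj 3 x') (dominates 3 y)))))

/-- The tokens on the component of the vertex `0` are aligned. -/
def aligned : Formula (Fin 8) :=
  ex 4 (ex 5 (ex 6 (ex 7 (and (near 0 4) (and (count .someS 2 (eq 2 4))
    (and (count .someS 2 (eq 2 5)) (and (count .someT 2 (eq 2 6)) (and (count .someT 2 (eq 2 7))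
      (and (dominatingEdge 4 5) (and (dominatingEdge 6 5) (and (dominatingEdge 6 7)
        (and (linked 4 6 5) (linked 5 7 6)))))))))))))

/-- Each component satisfies the condition for reconfigurability. -/
def reconfigurable : Formula (Fin 8) :=
  all 0 (and (count .same 2 (near 0 2)) (or flexible (or aligned (count .three 2 (near 0 2)))))

/-- Variable 0 names the component, 1 is bound only in `near`, 2 only in `dominates` and in counts,
3 only in `linked`, and 4 to 7 are the ends of edges. They are reused only in disjoint scopes. -/
theorem wf_reconfigurable : reconfigurable.wf = true := by
  decide

variable (I : DSRInstance) (e : Fin 8 → Fin I.n)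

/-- Here and below, the inequalities prevent the capture of an argument by a bound variable. -/
theorem eval_near {x y : Fin 8} (hx : x ≠ 1) (hy : y ≠ 1) :
    (near x y).Eval I e ↔ Near I.G (e x) (e y) := by
  simp only [near, Near, eval_or, eval_eq, eval_adj, eval_ex, eval_and, Function.update_self,
    Function.update_of_ne hx, Function.update_of_ne hy]

theorem eval_dominates {x y : Fin 8} (hx : x ≠ 2) (hy : y ≠ 2) :
    (dominates x y).Eval I e ↔ DominatesOn I.G (component I.G (e 0)) {e x, e y} := by
  simp only [dominates, eval_all, eval_or, eval_neg, eval_eq, eval_adj,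
    eval_near I _ (show (0 : Fin 8) ≠ 1 by decide) (show (2 : Fin 8) ≠ 1 by decide),
    Function.update_self, Function.update_of_ne hx, Function.update_of_ne hy,
    Function.update_of_ne (show (0 : Fin 8) ≠ 2 by decide)]
  simp [DominatesOn, component, imp_iff_not_or]

theorem eval_dominatingEdge {x y : Fin 8} (hx : x ≠ 2) (hy : y ≠ 2) :
    (dominatingEdge x y).Eval I e ↔
      IsDominatingEdge I.G (component I.G (e 0)) (e x) (e y) := by
  rw [dominatingEdge, eval_and, eval_dominates I e hx hy, eval_adj, IsDominatingEdge]

theorem eval_linked {x x' y : Fin 8} (hx : x ≠ 3) (hx' : x' ≠ 3) (hy : y ≠ 3) (hy' : y ≠ 2) :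
    (linked x x' y).Eval I e ↔
      Linked I.G (component I.G (e 0)) (e x) (e x') (e y) := by
  simp only [linked, Linked, eval_or, eval_eq, eval_adj, eval_ex, eval_and,
    eval_dominates I _ (show (3 : Fin 8) ≠ 2 by decide) hy', Function.update_self,
    Function.update_of_ne hx, Function.update_of_ne hx', Function.update_of_ne hy,
    Function.update_of_ne (show (0 : Fin 8) ≠ 3 by decide)]

theorem eval_flexible : flexible.Eval I e ↔ Flexible I.G (component I.G (e 0)) := by
  simp [flexible, Flexible, eval_or, eval_ex, eval_and, eval_neg, eval_adj, eval_near,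
    eval_dominates, eval_dominatingEdge, component]

theorem eval_someS {x : Fin 8} (hx : x ≠ 2) :
    (count .someS 2 (eq 2 x)).Eval I e ↔ e x ∈ I.Ds := by
  refine (eval_count (p := fun v => v = e x) .someS fun v => ?_).trans
    (Multiset.countP_pos.trans (by simp))
  rw [eval_eq, Function.update_self, Function.update_of_ne hx]

theorem eval_someT {x : Fin 8} (hx : x ≠ 2) :
    (count .someT 2 (eq 2 x)).Eval I e ↔ e x ∈ I.Dt := by
  refine (eval_count (p := fun v => v = e x) .someT fun v => ?_).trans
    (Multiset.countP_pos.trans (by simp))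
  rw [eval_eq, Function.update_self, Function.update_of_ne hx]

theorem eval_aligned : aligned.Eval I e ↔ Aligned I.G (component I.G (e 0)) I.Ds I.Dt := by
  simp [aligned, Aligned, eval_ex, eval_and, eval_near, eval_someS, eval_someT,
    eval_dominatingEdge, eval_linked, component]

theorem eval_reconfigurable :
    reconfigurable.Eval I e ↔ ∀ v, Compatible I.G I.Ds I.Dt v := by
  classical
  refine forall_congr' fun v => ?_
  have h : ∀ z, (near 0 2).Eval I (Function.update (Function.update e 0 v) 2 z) ↔
      z ∈ component I.G v := fun z => by
    simp [eval_near, component]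
  rw [eval_and, eval_or, eval_or, eval_flexible, eval_aligned, eval_count .same h,
    eval_count .three h, Function.update_self]
  exact Iff.rfl

end Formula

theorem mainTheorem3 :
    PolyTimeDecidable
      (fun I : {I : DSRInstance // IsCograph I.G} => I.1.encode)
      (fun I : {I : DSRInstance // IsCograph I.G} => Reconfigurable I.1.G I.1.Ds I.1.Dt) := by
  refine FCmd.polyTimeDecidable_of_formula (fun I : {I : DSRInstance // IsCograph I.G} => I.1)
    (fun I => ?_) _ Formula.reconfigurable Formula.wf_reconfigurable fun I e => ?_
  -- A cograph has a vertex, so the encoding has the first row on which the loops rely.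
  · have := I.2.nonempty
    exact Fin.pos_iff_nonempty.2 this
  · rw [Formula.eval_reconfigurable,
      reconfigurable_iff_compatible I.2 I.1.dominating_s I.1.dominating_t]
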